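/- All rings are commutative with unit. For a module $N$ over a ring $A$ write $N^{*}=\mathrm{Hom}_A(N,A)$; $N$ is \emph{reflexive} if the evaluation map $\sigma_N\colon N\to N^{**}$ is an isomorphism. For $n\ge 1$, $N$ is \emph{$n$-stably reflexive} over $A$ if it is reflexive and $\mathrm{Ext}^i_A(N,A)=0=\mathrm{Ext}^i_A(N^{*},A)$ for all $0<i<n$. An $A$-module is \emph{coherent} if it is finite and all its finite submodules are finitely presented; a ring is coherent if it is so as a module over itself. For a flat ring homomorphism $h\colon S\to R$, an $R$-module $M$ is \emph{$n$-stably reflexive with respect to $h$} (or over $S$) if $M$ is $S$-flat and, for every point $s$ in the image of the closed points of $\mathrm{Spec}\,R$ in $\mathrm{Spec}\,S$, the fibre $M\otimes_S k(s)$ is $n$-stably reflexive over $R\otimes_S k(s)$; it is \emph{stably reflexive with respect to $h$} if this holds for all $n\geq 1$. Let $h\colon S\to R$ be a flat ring homomorphism with $S$ noetherian, and let $M$ be an $R$-module. \textbf{(A)} Suppose $R$ is coherent, $M$ is coherent and $S$-flat, $n>1$, and $M$ is $n$-stably reflexive with respect to $h$. Then: (i) For any ring homomorphism $S\to S'$,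 with $R'=R\otimes_S S'$ and $h'=h\otimes_S S'\colon S'\to R'$, the base change $M'=M\otimes_S S'$ is $n$-stably reflexive with respect to $h'$, and also as an $R'$-module. (ii) The dual $M^{*}=\mathrm{Hom}_R(M,R)$ is $n$-stably reflexive with respect to $h$. (iii) For any ring homomorphism $S\to S'$ and any $S'$-module $I'$, the base change map $$M^{*}\otimes_S I'\longrightarrow \mathrm{Hom}_{R'}(M',R'\otimes_{S'}I'),\qquad \varphi\otimes u\longmapsto\bigl(m\otimes t\mapsto (\varphi(m)\otimes t)\otimes u\bigr)$$ is an isomorphism, and $\mathrm{Ext}^i_{R'}(M',R'\otimes_{S'}I')=0$ for all $0<i<n$. \textbf{(B)} Suppose $R$ is noetherian and $M$ is a finite $R$-module. Then $M$ is stably reflexive with respect to $h$ if and only if it is stably reflexive in the sense of Knudsen, that is, for all $S$-modules $I$: (a) the exchange map $\mathrm{Hom}_R(M,R)\otimes_S I\to\mathrm{Hom}_R(M,R\otimes_S I)$, $\varphi\otimes u\mapsto(m\mapsto\varphi(m)\otimes u)$, is an isomorphism; (b) the composition $M\otimes_S I\xrightarrow{\sigma_M\otimes\mathrm{id}_I}\mathrm{Hom}_R(M^{*},R)\otimes_S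 I\to\mathrm{Hom}_R(M^{*},R\otimes_S I)$, whose second map is the exchange map of $M^{*}$, is an isomorphism; and (c) $\mathrm{Ext}^i_R(M,R\otimes_S I)=0=\mathrm{Ext}^i_R(M^{*},R\otimes_S I)$ for all $i>0$. -/

import Mathlib

universe u

open TensorProduct CategoryTheory

/- For ring homomorphisms `S → R` and `S → T`, the ring `R ⊗[S] T` is an algebra over `R`
(first factor) and over `T` (second factor). -/
attribute [local instance] Algebra.TensorProduct.rightAlgebra

/-- `Ext^i_A(M, N) = 0`. -/
def ExtVanishes (A : Type u) [CommRing A] (M N : Type u) [AddCommGroup M] [Module A M]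
    [AddCommGroup N] [Module A N] (i : ℕ) : Prop :=
  Subsingleton (Abelian.Ext (ModuleCat.of A M) (ModuleCat.of A N) i)

/-- A module is coherent if it is finite and all its finite submodules are finitely presented. -/
def IsCoherentModule (A M : Type*) [CommRing A] [AddCommGroup M] [Module A M] : Prop :=
  Module.Finite A M ∧ ∀ P : Submodule A M, P.FG → Module.FinitePresentation A P

/-- A ring is coherent if it is coherent as a module over itself. -/
def IsCoherentRing (A : Type*) [CommRing A] : Prop :=
  IsCoherentModule A A

/-- `M` is `n`-stably reflexive over the ring `A` (absolute notion, for `n ≥ 1`): it is reflexive,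
and `Ext^i_A(M, A) = 0 = Ext^i_A(M^*, A)` for `0 < i < n`. -/
def IsNStablyReflexive (n : ℕ) (A M : Type u) [CommRing A] [AddCommGroup M] [Module A M] : Prop :=
  Module.IsReflexive A M ∧
    ∀ i : ℕ, 0 < i → i < n → ExtVanishes A M A i ∧ ExtVanishes A (Module.Dual A M) A i

/-- The base change `M ⊗_S T` of an `R`-module `M` along `S → T`, with its natural structure of
module over `R ⊗[S] T`. It is realised as `(R ⊗[S] T) ⊗[R] M`; see `baseChangeModuleEquiv`. -/
abbrev BaseChangeModule (S R T M : Type*) [CommRing S] [CommRing R] [CommRing T] [Algebra S R]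
    [Algebra S T] [AddCommGroup M] [Module R M] :=
  (R ⊗[S] T) ⊗[R] M

section BaseChangeModule

variable (S R T M : Type*) [CommRing S] [CommRing R] [CommRing T] [Algebra S R]
  [Algebra S T] [AddCommGroup M] [Module R M] [Module S M] [IsScalarTower S R M]

/-- The canonical isomorphism between the base change module and `M ⊗[S] T`. -/
noncomputable def baseChangeModuleEquiv : BaseChangeModule S R T M ≃ₗ[R] M ⊗[S] T :=
  TensorProduct.comm R (R ⊗[S] T) M ≪≫ₗ
    TensorProduct.AlgebraTensorModule.cancelBaseChange S R R M T

/-- The canonical isomorphism, on generators. -/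
theorem baseChangeModuleEquiv_tmul (r : R) (t : T) (m : M) :
    baseChangeModuleEquiv S R T M ((r ⊗ₜ t) ⊗ₜ m) = (r • m) ⊗ₜ t := by
  simp [baseChangeModuleEquiv]

end BaseChangeModule

/-- The image in `Spec S` of the set of closed points of `Spec R`. -/
def closedPointsImage (S R : Type*) [CommRing S] [CommRing R] [Algebra S R] :
    Set (PrimeSpectrum S) :=
  PrimeSpectrum.comap (algebraMap S R) '' {x | IsClosed ({x} : Set (PrimeSpectrum R))}

/-- The `R`-module `M` is `n`-stably reflexive with respect to the (flat) ring homomorphism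
`S → R`: it is `S`-flat, and for all `s` in the image of the closed points of `Spec R` the fibre
`M_s = M ⊗_S k(s)` is an `n`-stably reflexive module over `R_s = R ⊗_S k(s)`. -/
def IsNStablyReflexiveOver (n : ℕ) (S R M : Type u) [CommRing S] [CommRing R] [Algebra S R]
    [AddCommGroup M] [Module S M] [Module R M] [IsScalarTower S R M] : Prop :=
  Module.Flat S M ∧ ∀ s ∈ closedPointsImage S R,
    IsNStablyReflexive n (R ⊗[S] s.asIdeal.ResidueField)
      (BaseChangeModule S R s.asIdeal.ResidueField M)

/-- The `R`-module `M` is stably reflexive with respect to `S → R`. -/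
def IsStablyReflexiveOver (S R M : Type u) [CommRing S] [CommRing R] [Algebra S R]
    [AddCommGroup M] [Module S M] [Module R M] [IsScalarTower S R M] : Prop :=
  ∀ n : ℕ, 0 < n → IsNStablyReflexiveOver n S R M

section Maps

variable (S R M I : Type*) [CommRing S] [CommRing R] [Algebra S R] [AddCommGroup M] [Module R M]
  [AddCommGroup I] [Module S I]

/-- The exchange map `Hom_R(M, R) ⊗_S I → Hom_R(M, R ⊗_S I)`,
`φ ⊗ u ↦ (m ↦ φ m ⊗ u)`. -/
noncomputable def exchangeMap : Module.Dual R M ⊗[S] I →ₗ[R] (M →ₗ[R] R ⊗[S] I) :=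
  TensorProduct.AlgebraTensorModule.lift
    { toFun := fun φ =>
        { toFun := fun u => (TensorProduct.AlgebraTensorModule.mk S R R I).flip u ∘ₗ φ
          map_add' := fun u v => by ext m; simp
          map_smul' := fun a u => by ext m; simp }
      map_add' := fun φ ψ => by ext u m; simp [TensorProduct.add_tmul]
      map_smul' := fun r φ => by ext u m; simp [TensorProduct.smul_tmul'] }

@[simp]
theorem exchangeMap_tmul (φ : Module.Dual R M) (u : I) (m : M) :
    exchangeMap S R M I (φ ⊗ₜ u) m = φ m ⊗ₜ u := rfl

variable (T J : Type*) [CommRing T] [Algebra S T] [AddCommGroup J] [Module S J] [Module T J]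
  [IsScalarTower S T J]

/-- The base change map `Hom_R(M, R) ⊗_S J → Hom_{R'}(M', R' ⊗_T J)` for a `T`-module `J`, where
`R' = R ⊗_S T` and `M' = M ⊗_S T`. It sends `φ ⊗ u` to the `R'`-linear map with
`r' ⊗ m ↦ r' φ(m) ⊗ u`. -/
noncomputable def dualBaseChangeMap :
    Module.Dual R M ⊗[S] J →ₗ[R]
      (BaseChangeModule S R T M →ₗ[R ⊗[S] T] (R ⊗[S] T) ⊗[T] J) :=
  TensorProduct.AlgebraTensorModule.lift
    { toFun := fun φ =>
        { toFun := fun u => LinearMap.liftBaseChange (R ⊗[S] T)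
            (((TensorProduct.AlgebraTensorModule.mk T (R ⊗[S] T) (R ⊗[S] T) J).flip
              u).restrictScalars R ∘ₗ Algebra.linearMap R (R ⊗[S] T) ∘ₗ φ)
          map_add' := fun u v => by ext m; simp
          map_smul' := fun a u => by ext m; simp }
      map_add' := fun φ ψ => by ext u m; simp [TensorProduct.add_tmul]
      map_smul' := fun r φ => by ext u m; simp [TensorProduct.smul_tmul'] }

theorem dualBaseChangeMap_tmul (φ : Module.Dual R M) (u : J) (x : R ⊗[S] T) (m : M) :
    dualBaseChangeMap S R M T J (φ ⊗ₜ u) (x ⊗ₜ m) = (x * (φ m ⊗ₜ 1)) ⊗ₜ u := by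
  simp [dualBaseChangeMap, TensorProduct.smul_tmul']

/-- The base change map also respects the action of `T`, so that it is linear over `R ⊗_S T`. -/
theorem dualBaseChangeMap_smul (φ : Module.Dual R M) (t : T) (u : J)
    (y : BaseChangeModule S R T M) :
    dualBaseChangeMap S R M T J (φ ⊗ₜ (t • u)) y =
      (1 ⊗ₜ t : R ⊗[S] T) • dualBaseChangeMap S R M T J (φ ⊗ₜ u) y := by
  induction y using TensorProduct.induction_on with
  | zero => simp
  | add a b ha hb => simp only [map_add, ha, hb, smul_add]
  | tmul x m =>
    rw [dualBaseChangeMap_tmul, dualBaseChangeMap_tmul, ← TensorProduct.smul_tmul,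
      TensorProduct.smul_tmul', Algebra.smul_def, smul_eq_mul]
    rfl

end Maps

/-- Knudsen's notion: a finite `R`-module `M` is stably reflexive with respect to `S → R` if for
all `S`-modules `I`
* the exchange map `Hom_R(M, R) ⊗_S I → Hom_R(M, R ⊗_S I)` is an isomorphism,
* the composition `M ⊗_S I → Hom_R(M^*, R) ⊗_S I → Hom_R(M^*, R ⊗_S I)` of `σ_M ⊗ id_I` and the
  exchange map of `M^*` is an isomorphism, and
* `Ext^i_R(M, R ⊗_S I) = 0 = Ext^i_R(M^*, R ⊗_S I)` for all `i > 0`. -/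
def IsKnudsenStablyReflexive (S R M : Type u) [CommRing S] [CommRing R] [Algebra S R]
    [AddCommGroup M] [Module S M] [Module R M] [IsScalarTower S R M] : Prop :=
  Module.Finite R M ∧
    ∀ (I : Type u) [AddCommGroup I] [Module S I],
      Function.Bijective (exchangeMap S R M I) ∧
      Function.Bijective
        (exchangeMap S R (Module.Dual R M) I ∘ₗ
          (TensorProduct.AlgebraTensorModule.map (Module.Dual.eval R M) LinearMap.id :
            M ⊗[S] I →ₗ[R] Module.Dual R (Module.Dual R M) ⊗[S] I)) ∧
      ∀ i : ℕ, 0 < i →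
        ExtVanishes R M (R ⊗[S] I) i ∧ ExtVanishes R (Module.Dual R M) (R ⊗[S] I) i

/-! Everything passes through `IsUniversallyReflexive`: flatness of `M` and `M^*` over `S`,
reflexivity, bijective exchange maps and vanishing `Ext`, the last two for all `S`-modules `I`.
These conditions descend to any base change, and Knudsen's conditions imply them and follow from
them. The work is to derive them from the fibres.

Since `M` is `S`-flat, `Ext` over a fibre ring equals `Ext^i_R(M, R ⊗ k(s))`
(`extVanishes_baseChange_iff`). To replace `k(s)` by an arbitrary `I` (`extVanishes_tensor`),
dimension shifting reduces to `Ext^1`, that is, to extending maps `K → R ⊗ I` from a syzygy to a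
free module. This property is stable under extensions in `I`, so prime filtrations and noetherian
induction leave `I = S/p`. There the module of obstructions is finite over `R`, killed by `p`,
divisible by every element outside `p` (by the larger primes), and torsion if `p` lies below a
closed point (by the case `k(p)`). Nakayama's lemma makes it zero (`eq_zero_of_forall_prime`).

Vanishing of `Ext^1` for all `I` makes the dual of a free resolution universally exact in degree
one, so `M^*` is flat and commutes with base change (`flat_dual_and_exchangeMap_bijective`). Thus
fibres of `M^*` are duals of fibres, `M^*` inherits the hypothesis, and `M → M^{**}`, bijective on
fibres, is bijective (`bijective_of_fibres`). -/

/-! ### `Ext` through syzygies -/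

section ExtVanishes

variable {A : Type u} [CommRing A] {M M' N N' K F : Type u} [AddCommGroup M] [Module A M]
  [AddCommGroup M'] [Module A M'] [AddCommGroup N] [Module A N] [AddCommGroup N'] [Module A N']
  [AddCommGroup K] [Module A K] [AddCommGroup F] [Module A F]

/-- Vanishing of `Ext` only depends on the isomorphism classes of the modules. -/
theorem ExtVanishes.congr (e : M ≃ₗ[A] M') (e' : N ≃ₗ[A] N') {i : ℕ} (h : ExtVanishes A M N i) :
    ExtVanishes A M' N' i := by
  have : Subsingleton (Abelian.Ext (ModuleCat.of A M) (ModuleCat.of A N) i) := h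
  refine ⟨fun x y => ?_⟩
  have key : ∀ z : Abelian.Ext (ModuleCat.of A M') (ModuleCat.of A N') i, z =
      (Abelian.Ext.mk₀ e.toModuleIso.inv).comp
        (((Abelian.Ext.mk₀ e.toModuleIso.hom).comp
          (z.comp (Abelian.Ext.mk₀ e'.toModuleIso.inv) (add_zero i)) (zero_add i)).comp
            (Abelian.Ext.mk₀ e'.toModuleIso.hom) (add_zero i)) (zero_add i) := by
    intro z
    have h₁ : e.toModuleIso.inv ≫ e.toModuleIso.hom = 𝟙 _ := e.toModuleIso.inv_hom_id
    have h₂ : e'.toModuleIso.inv ≫ e'.toModuleIso.hom = 𝟙 _ := e'.toModuleIso.inv_hom_id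
    rw [Abelian.Ext.comp_assoc_of_third_deg_zero, Abelian.Ext.comp_assoc_of_second_deg_zero,
      Abelian.Ext.mk₀_comp_mk₀, h₂, Abelian.Ext.comp_mk₀_id, Abelian.Ext.mk₀_comp_mk₀_assoc, h₁,
      Abelian.Ext.mk₀_id_comp]
  rw [key x, key y]
  congr 2
  exact Subsingleton.elim _ _

theorem shortExact_moduleCat {f : K →ₗ[A] F} {g : F →ₗ[A] M} (hf : Function.Injective f)
    (hg : Function.Surjective g) (hfg : Function.Exact f g) :
    (ShortComplex.mk (ModuleCat.ofHom f) (ModuleCat.ofHom g)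
      (by ext x; exact hfg.apply_apply_eq_zero x)).ShortExact where
  exact := by
    rw [ShortComplex.ShortExact.moduleCat_exact_iff_function_exact]
    exact hfg
  mono_f := (ModuleCat.mono_iff_injective _).2 hf
  epi_g := (ModuleCat.epi_iff_surjective _).2 hg

/-- `Ext^1(M, N)` vanishes if and only if every map from the first syzygy extends. -/
theorem extVanishes_one_iff [Module.Projective A F] {f : K →ₗ[A] F} {g : F →ₗ[A] M}
    (hf : Function.Injective f) (hg : Function.Surjective g) (hfg : Function.Exact f g) :
    ExtVanishes A M N 1 ↔ ∀ φ : K →ₗ[A] N, ∃ ψ : F →ₗ[A] N, ψ ∘ₗ f = φ := by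
  have hS := shortExact_moduleCat hf hg hfg
  constructor
  · intro h φ
    have : Subsingleton (Abelian.Ext (ModuleCat.of A M) (ModuleCat.of A N) 1) := h
    obtain ⟨x, hx⟩ := Abelian.Ext.contravariant_sequence_exact₁ hS _
      (Abelian.Ext.mk₀ (ModuleCat.ofHom φ)) (add_zero 1) (Subsingleton.elim _ _)
    obtain ⟨ψ, rfl⟩ := Abelian.Ext.addEquiv₀.symm.surjective x
    refine ⟨ψ.hom, ?_⟩
    simp only [Abelian.Ext.addEquiv₀_symm_apply, Abelian.Ext.mk₀_comp_mk₀] at hx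
    have := Abelian.Ext.addEquiv₀.symm.injective hx
    exact congrArg ModuleCat.Hom.hom this
  · intro h
    refine subsingleton_of_forall_eq 0 fun x => ?_
    have : Projective (ModuleCat.of A F) := (IsProjective.iff_projective _).1 inferInstance
    obtain ⟨y, rfl⟩ := Abelian.Ext.contravariant_sequence_exact₃ hS _ x
      (Abelian.Ext.eq_zero_of_projective (P := ModuleCat.of A F) _) (add_zero 1)
    obtain ⟨φ, rfl⟩ := Abelian.Ext.addEquiv₀.symm.surjective y
    obtain ⟨ψ, hψ⟩ := h φ.hom
    have : φ = ModuleCat.ofHom f ≫ ModuleCat.ofHom ψ := by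
      ext x
      exact (LinearMap.congr_fun hψ x).symm
    rw [this]
    simp only [Abelian.Ext.addEquiv₀_symm_apply, ← Abelian.Ext.mk₀_comp_mk₀]
    exact hS.extClass_comp_assoc _

/-- Dimension shifting. -/
theorem extVanishes_succ_iff [Module.Projective A F] {f : K →ₗ[A] F} {g : F →ₗ[A] M}
    (hf : Function.Injective f) (hg : Function.Surjective g) (hfg : Function.Exact f g) (i : ℕ) :
    ExtVanishes A M N (i + 2) ↔ ExtVanishes A K N (i + 1) := by
  have hS := shortExact_moduleCat hf hg hfg
  have : Projective (ModuleCat.of A F) := (IsProjective.iff_projective _).1 inferInstance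
  constructor
  · intro h
    have : Subsingleton (Abelian.Ext (ModuleCat.of A M) (ModuleCat.of A N) (i + 2)) := h
    refine subsingleton_of_forall_eq 0 fun x => ?_
    obtain ⟨y, rfl⟩ := Abelian.Ext.contravariant_sequence_exact₁ hS _ x
      (by omega : 1 + (i + 1) = i + 2) (Subsingleton.elim _ _)
    rw [Abelian.Ext.eq_zero_of_projective (P := ModuleCat.of A F) y, Abelian.Ext.comp_zero]
  · intro h
    have : Subsingleton (Abelian.Ext (ModuleCat.of A K) (ModuleCat.of A N) (i + 1)) := h
    refine subsingleton_of_forall_eq 0 fun x => ?_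
    obtain ⟨y, rfl⟩ := Abelian.Ext.contravariant_sequence_exact₃ hS _ x
      (Abelian.Ext.eq_zero_of_projective (P := ModuleCat.of A F) _) (by omega : 1 + (i + 1) = i + 2)
    have hy : y = 0 := this.elim _ _
    rw [hy, Abelian.Ext.comp_zero]

end ExtVanishes

/-! ### Flatness of submodules -/

section Flat

variable {S : Type u} [CommRing S] {N G P : Type u} [AddCommGroup N] [Module S N]
  [AddCommGroup G] [Module S G] [AddCommGroup P] [Module S P] [Module.Flat S G]

/-- A universally injective submodule of a flat module is flat. -/
theorem flat_of_rTensor_injective (f : N →ₗ[S] G)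
    (hf : ∀ (A : Type u) [AddCommGroup A] [Module S A], Function.Injective (f.rTensor A)) :
    Module.Flat S N := by
  rw [Module.Flat.iff_lTensor_preserves_injective_linearMap]
  intro A A' _ _ _ _ i hi
  have h : Function.Injective (i.lTensor G ∘ₗ f.rTensor A) :=
    (Module.Flat.lTensor_preserves_injective_linearMap i hi).comp (hf A)
  rw [LinearMap.lTensor_comp_rTensor, ← LinearMap.rTensor_comp_lTensor] at h
  exact Function.Injective.of_comp (f := f.rTensor A') h

/-- The kernel of a surjection between flat modules is flat. -/
theorem flat_of_exact [Module.Flat S P] (f : N →ₗ[S] G) (g : G →ₗ[S] P)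
    (hf : Function.Injective f) (hg : Function.Surjective g) (hfg : Function.Exact f g) :
    Module.Flat S N :=
  flat_of_rTensor_injective f fun A _ _ => (LinearMap.lTensor_inj_iff_rTensor_inj A f).1
    (LinearMap.lTensor_injective_of_exact_of_flat g hg f hf hfg A)

end Flat

/-! ### Change of rings for `Ext` -/

section ChangeOfRings

/-- If the `R`-module `B` is isomorphic to `R ⊗[S] T`, then `B ⊗[R] X` is isomorphic to
`X ⊗[S] T`. -/
noncomputable def tensorEquivOfEquiv {S R : Type*} [CommRing S] [CommRing R]
    [Algebra S R] {T B : Type*} [AddCommGroup T] [Module S T] [AddCommGroup B] [Module R B]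
    (e : B ≃ₗ[R] R ⊗[S] T) (X : Type*) [AddCommGroup X] [Module R X] [Module S X]
    [IsScalarTower S R X] : B ⊗[R] X ≃ₗ[R] X ⊗[S] T :=
  TensorProduct.congr e (LinearEquiv.refl R X) ≪≫ₗ TensorProduct.comm R (R ⊗[S] T) X ≪≫ₗ
    TensorProduct.AlgebraTensorModule.cancelBaseChange S R R X T

/-- If the `R`-module `B` is of the form `R ⊗[S] T`, tensoring with `B` over `R` preserves
injectivity of maps with `S`-flat cokernel. -/
theorem lTensor_injective_of_equiv_tensorProduct {S R : Type*} [CommRing S] [CommRing R]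
    [Algebra S R] {T B K F M : Type*} [AddCommGroup T] [Module S T] [AddCommGroup B] [Module R B]
    (e : B ≃ₗ[R] R ⊗[S] T) [AddCommGroup K] [Module R K] [Module S K] [IsScalarTower S R K]
    [AddCommGroup F] [Module R F] [Module S F] [IsScalarTower S R F] [AddCommGroup M] [Module R M]
    [Module S M] [IsScalarTower S R M] [Module.Flat S M]
    {f : K →ₗ[R] F} {g : F →ₗ[R] M} (hf : Function.Injective f) (hg : Function.Surjective g)
    (hfg : Function.Exact f g) : Function.Injective (f.lTensor B) := by
  -- Flatness of `M` over `S` gives injectivity after `⊗[S] T`; the rest transports it along `B ⊗[R]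
  -- X ≃ X ⊗[S] T`.
  have h := LinearMap.lTensor_injective_of_exact_of_flat (R := S) (g.restrictScalars S) hg
    (f.restrictScalars S) hf hfg T
  let E₁ := tensorEquivOfEquiv e K
  let E₂ := tensorEquivOfEquiv e F
  have key : (TensorProduct.AlgebraTensorModule.rTensor S T f) ∘ₗ E₁.toLinearMap =
      E₂.toLinearMap ∘ₗ f.lTensor B := by
    ext b x
    simp only [E₁, E₂, tensorEquivOfEquiv, TensorProduct.AlgebraTensorModule.curry_apply,
      TensorProduct.curry_apply,
      LinearMap.restrictScalars_self, LinearMap.coe_comp, LinearEquiv.coe_coe, Function.comp_apply,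
      LinearEquiv.trans_apply, TensorProduct.congr_tmul, LinearEquiv.refl_apply,
      TensorProduct.comm_tmul, LinearMap.lTensor_tmul]
    induction e b with
    | zero => simp
    | add x y hx hy => simp only [TensorProduct.tmul_add, map_add, hx, hy]
    | tmul r t => simp
  have h' : Function.Injective (TensorProduct.AlgebraTensorModule.rTensor S T f) := by
    have : (f.restrictScalars S).rTensor T =
        (TensorProduct.AlgebraTensorModule.rTensor S T f).restrictScalars S := rfl
    have h2 := (LinearMap.lTensor_inj_iff_rTensor_inj T (f.restrictScalars S)).1 h
    rwa [this] at h2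
  have : Function.Injective (E₂.toLinearMap ∘ₗ f.lTensor B) := by
    rw [← key]
    exact h'.comp E₁.injective
  exact Function.Injective.of_comp (f := E₂) this

section

variable {R B : Type u} [CommRing R] [CommRing B] [Algebra R B] {M N K F : Type u}
  [AddCommGroup M] [Module R M] [AddCommGroup K] [Module R K] [AddCommGroup F] [Module R F]
  [AddCommGroup N] [Module B N] [Module.Projective R F]
  {f : K →ₗ[R] F} {g : F →ₗ[R] M}

/-- The presentation stays exact over `B`, and the adjunction between extension and restriction of
scalars matches the two extension problems. -/
theorem extVanishes_one_baseChange_iff [Module R N] [IsScalarTower R B N]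
    (hf : Function.Injective f) (hg : Function.Surjective g) (hfg : Function.Exact f g)
    (hf' : Function.Injective (f.lTensor B)) :
    ExtVanishes B (B ⊗[R] M) N 1 ↔ ExtVanishes R M N 1 := by
  have hg' : Function.Surjective (g.baseChange B) := LinearMap.lTensor_surjective B hg
  have hfg' : Function.Exact (f.baseChange B) (g.baseChange B) := lTensor_exact B hfg hg
  rw [extVanishes_one_iff hf hg hfg, extVanishes_one_iff (f := f.baseChange B) hf' hg' hfg']
  constructor
  · intro h φ
    obtain ⟨ψ, hψ⟩ := h (φ.liftBaseChange B)
    refine ⟨(LinearMap.liftBaseChangeEquiv B).symm ψ, ?_⟩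
    ext x
    have := LinearMap.congr_fun hψ (1 ⊗ₜ x)
    simpa using this
  · intro h φ
    obtain ⟨ψ, hψ⟩ := h ((LinearMap.liftBaseChangeEquiv B).symm φ)
    refine ⟨ψ.liftBaseChange B, ?_⟩
    ext x
    have := LinearMap.congr_fun hψ x
    simpa using this

theorem extVanishes_succ_baseChange_iff (hg : Function.Surjective g)
    (hfg : Function.Exact f g) (hf' : Function.Injective (f.lTensor B)) (i : ℕ) :
    ExtVanishes B (B ⊗[R] M) N (i + 2) ↔ ExtVanishes B (B ⊗[R] K) N (i + 1) := by
  have hg' : Function.Surjective (g.baseChange B) := LinearMap.lTensor_surjective B hg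
  have hfg' : Function.Exact (f.baseChange B) (g.baseChange B) := lTensor_exact B hfg hg
  exact extVanishes_succ_iff (f := f.baseChange B) hf' hg' hfg' i

end

/-- Every module is a quotient of a free module. -/
theorem exists_free_presentation (R M : Type u) [CommRing R] [AddCommGroup M] [Module R M] :
    ∃ (F : Type u) (_ : AddCommGroup F) (_ : Module R F) (_ : Module.Free R F) (g : F →ₗ[R] M),
      Function.Surjective g :=
  ⟨M →₀ R, inferInstance, inferInstance, inferInstance, Finsupp.linearCombination R id,
    Finsupp.linearCombination_id_surjective R M⟩

variable {S R : Type u} [CommRing S] [CommRing R] [Algebra S R] [Module.Flat S R]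

/-- Change of rings for the vanishing of `Ext`. -/
theorem extVanishes_baseChange_iff {B T : Type u} [CommRing B] [Algebra R B] [AddCommGroup T]
    [Module S T] (e : B ≃ₗ[R] R ⊗[S] T) {N : Type u} [AddCommGroup N] [Module R N] [Module B N]
    [IsScalarTower R B N] (i : ℕ) (M : Type u) [AddCommGroup M] [Module R M] [Module S M]
    [IsScalarTower S R M] [Module.Flat S M] :
    ExtVanishes B (B ⊗[R] M) N (i + 1) ↔ ExtVanishes R M N (i + 1) := by
  induction i generalizing M with
  | zero =>
    obtain ⟨F, _, _, _, g, hg⟩ := exists_free_presentation R M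
    let _ : Module S F := Module.compHom F (algebraMap S R)
    have : IsScalarTower S R F := .of_algebraMap_smul fun _ _ => rfl
    have hf := (LinearMap.ker g).injective_subtype
    have hfg := LinearMap.exact_subtype_ker_map g
    exact extVanishes_one_baseChange_iff hf hg hfg
      (lTensor_injective_of_equiv_tensorProduct e hf hg hfg)
  | succ i ih =>
    obtain ⟨F, _, _, _, g, hg⟩ := exists_free_presentation R M
    let _ : Module S F := Module.compHom F (algebraMap S R)
    have : IsScalarTower S R F := .of_algebraMap_smul fun _ _ => rfl
    have hf := (LinearMap.ker g).injective_subtype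
    have hfg := LinearMap.exact_subtype_ker_map g
    -- The syzygy must be `S`-flat for the induction hypothesis to apply to it.
    have : Module.Flat S F := Module.Flat.trans S R F
    have : Module.Flat S (LinearMap.ker g) := flat_of_exact
      ((LinearMap.ker g).subtype.restrictScalars S) (g.restrictScalars S) hf hg hfg
    rw [extVanishes_succ_baseChange_iff hg hfg
      (lTensor_injective_of_equiv_tensorProduct e hf hg hfg), extVanishes_succ_iff hf hg hfg]
    exact ih _

end ChangeOfRings

/-! ### Coherent rings and modules -/

section Coherent

variable {R : Type*} [CommRing R] {M N P : Type*} [AddCommGroup M] [Module R M]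
  [AddCommGroup N] [Module R N] [AddCommGroup P] [Module R P]

theorem IsCoherentModule.of_injective (hN : IsCoherentModule R N) [Module.Finite R M]
    (f : M →ₗ[R] N) (hf : Function.Injective f) : IsCoherentModule R M := by
  refine ⟨inferInstance, fun Q hQ => ?_⟩
  have := hN.2 (Q.map f) (hQ.map f)
  exact .of_equiv (Submodule.equivMapOfInjective f hf Q).symm

theorem IsCoherentModule.finitePresentation (hM : IsCoherentModule R M) :
    Module.FinitePresentation R M := by
  have := hM.1
  have := hM.2 ⊤ Module.Finite.fg_top
  exact .of_equiv (Submodule.topEquiv (R := R) (M := M))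

/-- A finite `Q ≤ M × N` is an extension of its image in `N`, finitely presented by coherence, by a
kernel that is therefore finite and embeds in `M`. -/
theorem IsCoherentModule.prod (hM : IsCoherentModule R M) (hN : IsCoherentModule R N) :
    IsCoherentModule R (M × N) := by
  have := hM.1
  have := hN.1
  refine ⟨inferInstance, fun Q hQ => ?_⟩
  have : Module.Finite R Q := .of_fg hQ
  let q : Q →ₗ[R] N := LinearMap.snd R M N ∘ₗ Q.subtype
  have hq : (LinearMap.range q).FG := by
    rw [LinearMap.range_eq_map]
    exact Module.Finite.fg_top.map q
  have := hN.2 _ hq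
  have hk : (LinearMap.ker q.rangeRestrict).FG :=
    Module.FinitePresentation.fg_ker _ q.surjective_rangeRestrict
  have : Module.Finite R (LinearMap.ker q.rangeRestrict) := .of_fg hk
  let j : LinearMap.ker q.rangeRestrict →ₗ[R] M :=
    LinearMap.fst R M N ∘ₗ Q.subtype ∘ₗ (LinearMap.ker q.rangeRestrict).subtype
  have hj : Function.Injective j := by
    rw [injective_iff_map_eq_zero]
    rintro ⟨⟨⟨a, b⟩, h⟩, hx⟩ (h0 : a = 0)
    have h1 : b = 0 := congrArg Subtype.val (LinearMap.mem_ker.1 hx)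
    subst h0 h1
    rfl
  have := (IsCoherentModule.of_injective (M := LinearMap.ker q.rangeRestrict) hM j
    hj).finitePresentation
  exact Module.finitePresentation_of_ker _ q.surjective_rangeRestrict

theorem IsCoherentRing.isCoherentModule_pi (hR : IsCoherentRing R) (n : ℕ) :
    IsCoherentModule R (Fin n → R) := by
  have h {N N' : Type _} [AddCommGroup N] [AddCommGroup N'] [Module R N] [Module R N']
      (e : N ≃ₗ[R] N') (h : IsCoherentModule R N) : IsCoherentModule R N' := by
    have := h.1
    have : Module.Finite R N' := .equiv e
    exact h.of_injective e.symm.toLinearMap e.symm.injective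
  induction n with
  | zero => exact ⟨inferInstance, fun _ _ => inferInstance⟩
  | succ n ih => exact h (Fin.consLinearEquiv R fun _ => R) (hR.prod ih)

/-- Over a coherent ring every finitely presented module is coherent. -/
theorem IsCoherentRing.isCoherentModule (hR : IsCoherentRing R) [Module.FinitePresentation R M] :
    IsCoherentModule R M := by
  obtain ⟨n, f, hf⟩ := Module.Finite.exists_fin' R M
  refine ⟨inferInstance, fun Q hQ => ?_⟩
  have hk := Module.FinitePresentation.fg_ker f hf
  -- The preimage of `Q` in the free module is finite, hence finitely presented, and `Q` is its
  -- quotient by the finite module `ker f`.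
  have hQ' : (Q.comap f).FG := by
    refine Submodule.fg_of_fg_map_of_fg_inf_ker f ?_ ?_
    · rwa [Submodule.map_comap_eq_of_surjective hf]
    · rwa [inf_eq_right.2 (LinearMap.ker_le_comap f)]
  have := (hR.isCoherentModule_pi n).2 _ hQ'
  let g : Q.comap f →ₗ[R] Q := f.restrict fun x hx => hx
  refine Module.finitePresentation_of_surjective g ?_ ?_
  · rintro ⟨y, hy⟩
    obtain ⟨x, rfl⟩ := hf y
    exact ⟨⟨x, hy⟩, rfl⟩
  · have : (LinearMap.ker g).map (Q.comap f).subtype = LinearMap.ker f := by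
      ext x
      simp only [Submodule.mem_map, LinearMap.mem_ker, Submodule.subtype_apply]
      constructor
      · rintro ⟨y, hy, rfl⟩
        exact congrArg Subtype.val hy
      · intro hx
        exact ⟨⟨x, by simp [hx]⟩, Subtype.ext hx, rfl⟩
    rw [← this] at hk
    exact Submodule.fg_of_fg_map_injective _ Subtype.val_injective hk

theorem isCoherentRing_of_isNoetherianRing [IsNoetherianRing R] : IsCoherentRing R :=
  ⟨inferInstance, fun _ _ => Module.finitePresentation_of_finite _ _⟩

theorem IsCoherentRing.fg_ker (hR : IsCoherentRing R) [Module.Finite R M]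
    [Module.FinitePresentation R N] (f : M →ₗ[R] N) : (LinearMap.ker f).FG := by
  have hr : (LinearMap.range f).FG := by
    rw [LinearMap.range_eq_map]
    exact Module.Finite.fg_top.map f
  have := hR.isCoherentModule.2 _ hr
  rw [← LinearMap.ker_rangeRestrict]
  exact Module.FinitePresentation.fg_ker _ f.surjective_rangeRestrict

theorem IsCoherentRing.finitePresentation_ker (hR : IsCoherentRing R)
    [Module.FinitePresentation R M] [Module.FinitePresentation R N] (f : M →ₗ[R] N) :
    Module.FinitePresentation R (LinearMap.ker f) :=
  hR.isCoherentModule.2 _ (hR.fg_ker f)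

/-- Over a coherent ring the module of homomorphisms between finitely presented modules is
finitely presented. -/
theorem IsCoherentRing.finitePresentation_hom (hR : IsCoherentRing R)
    [Module.FinitePresentation R M] [Module.FinitePresentation R N] :
    Module.FinitePresentation R (M →ₗ[R] N) := by
  obtain ⟨n, m, f, g, hf, hfg⟩ := Module.FinitePresentation.exists_fin' R M
  have (k : ℕ) : Module.FinitePresentation R ((Fin k → R) →ₗ[R] N) :=
    .of_equiv ((Pi.basisFun R (Fin k)).constr R)
  -- Left exactness of `Hom` presents `Hom(M, N)` as the kernel of a map between finite powers of
  -- `N`.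
  have := hR.finitePresentation_ker (LinearMap.lcomp R N g)
  have hex : LinearMap.range (LinearMap.lcomp R N f) = LinearMap.ker (LinearMap.lcomp R N g) :=
    (LinearMap.exact_iff.1 (LinearMap.exact_lcomp_of_exact_of_surjective N hfg hf)).symm
  rw [← hex] at this
  exact .of_equiv (LinearEquiv.ofInjective _ (LinearMap.lcomp_injective_of_surjective f hf)).symm

end Coherent

/-! ### Extending linear maps -/

section Extension

variable {R : Type*} [CommRing R] {K F N N' N'' : Type*} [AddCommGroup K] [Module R K]
  [AddCommGroup F] [Module R F] [AddCommGroup N] [Module R N] [AddCommGroup N'] [Module R N']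
  [AddCommGroup N''] [Module R N'']

/-- A linear map whose values are in the range of an injective map factors through it. -/
theorem LinearMap.exists_comp_eq_of_injective (i : N' →ₗ[R] N) (hi : Function.Injective i)
    (φ : K →ₗ[R] N) (h : ∀ x, φ x ∈ LinearMap.range i) : ∃ φ' : K →ₗ[R] N', i ∘ₗ φ' = φ := by
  refine ⟨(LinearEquiv.ofInjective i hi).symm.toLinearMap ∘ₗ φ.codRestrict _ h, ?_⟩
  ext x
  exact congrArg Subtype.val ((LinearEquiv.ofInjective i hi).apply_symm_apply
    (φ.codRestrict _ h x))

/-- Every linear map from `K` to `N` extends along `f : K → F`. -/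
def ExtendsAlong (f : K →ₗ[R] F) (N : Type*) [AddCommGroup N] [Module R N] : Prop :=
  ∀ φ : K →ₗ[R] N, ∃ ψ : F →ₗ[R] N, ψ ∘ₗ f = φ

theorem ExtendsAlong.of_equiv {f : K →ₗ[R] F} (h : ExtendsAlong f N) (e : N ≃ₗ[R] N') :
    ExtendsAlong f N' := fun φ => by
  obtain ⟨ψ, hψ⟩ := h (e.symm.toLinearMap ∘ₗ φ)
  refine ⟨e.toLinearMap ∘ₗ ψ, ?_⟩
  rw [LinearMap.comp_assoc, hψ]
  ext x
  simp

variable [Module.Projective R F] {i : N' →ₗ[R] N} {π : N →ₗ[R] N''}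

/-- Extend `π ∘ φ` to `F`, lift the extension to `N` by projectivity and subtract: the difference
lands in `N'`. -/
theorem ExtendsAlong.exists_decomposition {f : K →ₗ[R] F} (h : ExtendsAlong f N'')
    (hi : Function.Injective i) (hπ : Function.Surjective π) (hiπ : Function.Exact i π)
    (φ : K →ₗ[R] N) : ∃ (φ' : K →ₗ[R] N') (ψ : F →ₗ[R] N), φ = i ∘ₗ φ' + ψ ∘ₗ f := by
  obtain ⟨ψ'', hψ''⟩ := h (π ∘ₗ φ)
  obtain ⟨ψ, hψ⟩ := Module.projective_lifting_property π ψ'' hπ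
  obtain ⟨φ', hφ'⟩ := LinearMap.exists_comp_eq_of_injective i hi (φ - ψ ∘ₗ f) fun x => by
    refine (hiπ _).1 ?_
    have h₁ := LinearMap.congr_fun hψ'' x
    have h₂ := LinearMap.congr_fun hψ (f x)
    simp only [LinearMap.comp_apply] at h₁ h₂
    simp [h₁, h₂]
  exact ⟨φ', ψ, by rw [hφ', sub_add_cancel]⟩

theorem ExtendsAlong.of_exact {f : K →ₗ[R] F} (h' : ExtendsAlong f N') (h'' : ExtendsAlong f N'')
    (hi : Function.Injective i) (hπ : Function.Surjective π) (hiπ : Function.Exact i π) :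
    ExtendsAlong f N := fun φ => by
  obtain ⟨φ', ψ, rfl⟩ := h''.exists_decomposition hi hπ hiπ φ
  obtain ⟨ψ', rfl⟩ := h' φ'
  exact ⟨i ∘ₗ ψ' + ψ, by rw [LinearMap.add_comp, LinearMap.comp_assoc]⟩

end Extension

/-! ### From residue fields to all coefficient modules -/

section Vanishing

/-- A form of Nakayama's lemma: a finite `R`-module killed by the prime `p` of `S`, divisible by the
elements outside `p`, and torsion with respect to these if `p` lies below a closed point,
vanishes. -/
theorem eq_zero_of_forall_prime {S R T : Type*} [CommRing S] [CommRing R] [Algebra S R]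
    [AddCommGroup T] [Module R T] [Module.Finite R T] (p : PrimeSpectrum S)
    (h₁ : ∀ a ∈ p.asIdeal, ∀ x : T, algebraMap S R a • x = 0)
    (h₂ : ∀ a ∉ p.asIdeal, ∀ x : T, ∃ y : T, algebraMap S R a • y = x)
    (h₃ : p ∈ closedPointsImage S R → ∀ x : T, ∃ a ∉ p.asIdeal, algebraMap S R a • x = 0)
    (x : T) : x = 0 := by
  by_contra hx
  have hne : Ideal.torsionOf R T x ≠ ⊤ := by
    rwa [Ne, Ideal.torsionOf_eq_top_iff]
  obtain ⟨m, hm, hle⟩ := Ideal.exists_le_maximal _ hne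
  let y : PrimeSpectrum R := ⟨m, hm.isPrime⟩
  have hq : PrimeSpectrum.comap (algebraMap S R) y ∈ closedPointsImage S R :=
    ⟨y, (PrimeSpectrum.isClosed_singleton_iff_isMaximal y).2 hm, rfl⟩
  have hmem : ∀ r : R, r • x = 0 → r ∈ m := fun r hr => hle ((Ideal.mem_torsionOf_iff _ _).2 hr)
  have hpq : p.asIdeal ≤ m.comap (algebraMap S R) := fun a ha => hmem _ (h₁ a ha x)
  -- The contraction of `m` contains `p`. If they are equal, `h₃` gives an element outside `p`
  -- annihilating `x`, hence in `m`, a contradiction. Otherwise `m` contains the image of some `a ∉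
  -- p`, by which `T` is divisible; so `T = mT` and Nakayama applies.
  by_cases heq : m.comap (algebraMap S R) ≤ p.asIdeal
  · have hp : PrimeSpectrum.comap (algebraMap S R) y = p :=
      PrimeSpectrum.ext (le_antisymm heq hpq)
    obtain ⟨a, ha, hax⟩ := h₃ (hp ▸ hq) x
    exact ha (heq (hmem _ hax))
  · obtain ⟨a, ham, hap⟩ := SetLike.not_le_iff_exists.1 heq
    have hle : (⊤ : Submodule R T) ≤ m • (⊤ : Submodule R T) := fun z _ => by
      obtain ⟨w, rfl⟩ := h₂ a hap z
      exact Submodule.smul_mem_smul ham trivial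
    obtain ⟨r, hr, hr'⟩ := Submodule.exists_sub_one_mem_and_smul_eq_zero_of_fg_of_le_smul m ⊤
      Module.Finite.fg_top hle
    have hrm := hmem r (hr' x trivial)
    refine hm.ne_top ((Ideal.eq_top_iff_one m).2 ?_)
    simpa using m.sub_mem hrm hr

/-- The Nakayama argument is applied to the cokernel of restriction `Hom(F, N) → Hom(K, N)`. -/
theorem ExtendsAlong.of_forall_prime {S R K F N : Type*} [CommRing S] [CommRing R] [Algebra S R]
    [AddCommGroup K] [Module R K] [AddCommGroup F] [Module R F] [AddCommGroup N] [Module R N]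
    [Module.Finite R (K →ₗ[R] N)] (f : K →ₗ[R] F) (p : PrimeSpectrum S)
    (h₁ : ∀ a ∈ p.asIdeal, ∀ φ : K →ₗ[R] N, algebraMap S R a • φ = 0)
    (h₂ : ∀ a ∉ p.asIdeal, ∀ φ : K →ₗ[R] N, ∃ (φ' : K →ₗ[R] N) (ψ : F →ₗ[R] N),
      φ = algebraMap S R a • φ' + ψ ∘ₗ f)
    (h₃ : p ∈ closedPointsImage S R → ∀ φ : K →ₗ[R] N, ∃ a ∉ p.asIdeal, ∃ ψ : F →ₗ[R] N,
      ψ ∘ₗ f = algebraMap S R a • φ) : ExtendsAlong f N := by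
  let X := LinearMap.range (LinearMap.lcomp R N f)
  suffices h : ∀ x : (K →ₗ[R] N) ⧸ X, x = 0 from fun φ =>
    (Submodule.Quotient.mk_eq_zero X).1 (h (Submodule.Quotient.mk φ))
  refine eq_zero_of_forall_prime (R := R) p ?_ ?_ ?_
  · intro a ha x
    obtain ⟨φ, rfl⟩ := Submodule.Quotient.mk_surjective X x
    rw [← Submodule.Quotient.mk_smul, h₁ a ha, Submodule.Quotient.mk_zero]
  · intro a ha x
    obtain ⟨φ, rfl⟩ := Submodule.Quotient.mk_surjective X x
    obtain ⟨φ', ψ, rfl⟩ := h₂ a ha φ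
    refine ⟨Submodule.Quotient.mk φ', ?_⟩
    rw [← Submodule.Quotient.mk_smul, Submodule.Quotient.eq]
    exact ⟨-ψ, by ext x; simp⟩
  · intro hmem x
    obtain ⟨φ, rfl⟩ := Submodule.Quotient.mk_surjective X x
    obtain ⟨a, ha, ψ, hψ⟩ := h₃ hmem φ
    refine ⟨a, ha, ?_⟩
    rw [← Submodule.Quotient.mk_smul, Submodule.Quotient.mk_eq_zero]
    exact ⟨ψ, hψ⟩

variable {S R : Type u} [CommRing S] [CommRing R] [Algebra S R] [Module.Flat S R]
  {K F : Type u} [AddCommGroup K] [Module R K] [AddCommGroup F] [Module R F]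

/-- The functor `R ⊗[S] -` from `S`-modules to `R`-modules, on maps. -/
abbrev tensorMap (S R : Type*) [CommRing S] [CommRing R] [Algebra S R] {I J : Type*}
    [AddCommGroup I] [Module S I] [AddCommGroup J] [Module S J] (g : I →ₗ[S] J) :
    R ⊗[S] I →ₗ[R] R ⊗[S] J :=
  TensorProduct.AlgebraTensorModule.lTensor R R g

theorem ExtendsAlong.of_exact_tensor [Module.Projective R F] {f : K →ₗ[R] F} {I I' I'' : Type*}
    [AddCommGroup I] [Module S I] [AddCommGroup I'] [Module S I'] [AddCommGroup I''] [Module S I'']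
    {i : I' →ₗ[S] I} {π : I →ₗ[S] I''} (hi : Function.Injective i) (hπ : Function.Surjective π)
    (hiπ : Function.Exact i π) (h' : ExtendsAlong f (R ⊗[S] I'))
    (h'' : ExtendsAlong f (R ⊗[S] I'')) : ExtendsAlong f (R ⊗[S] I) :=
  .of_exact (i := tensorMap S R i) (π := tensorMap S R π) h' h''
    (Module.Flat.lTensor_preserves_injective_linearMap i hi) (LinearMap.lTensor_surjective R hπ)
    (lTensor_exact R hiπ hπ)

/-- Dévissage along a prime filtration of `I`. The ideal `J` records which primes can occur: each of
them contains the annihilator of `I`. -/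
theorem ExtendsAlong.tensor_of_finite [IsNoetherianRing S] [Module.Projective R F] {f : K →ₗ[R] F}
    (J : Ideal S)
    (h : ∀ q : PrimeSpectrum S, J ≤ q.asIdeal → ExtendsAlong f (R ⊗[S] (S ⧸ q.asIdeal)))
    (I : Type u) [AddCommGroup I] [Module S I] [Module.Finite S I]
    (hJ : ∀ a ∈ J, ∀ x : I, a • x = 0) :
    ExtendsAlong f (R ⊗[S] I) := by
  revert hJ
  refine IsNoetherianRing.induction_on_isQuotientEquivQuotientPrime S (M := I) inferInstance
    (motive := fun I _ _ _ => (∀ a ∈ J, ∀ x : I, a • x = 0) → ExtendsAlong f (R ⊗[S] I)) ?_ ?_ ?_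
  · intro N _ _ _ _ _ φ
    exact ⟨0, by ext; exact Subsingleton.elim _ _⟩
  · intro N _ _ _ p e hJ
    refine (h p fun a ha => ?_).of_equiv
      (TensorProduct.AlgebraTensorModule.congr (LinearEquiv.refl R R) e.symm)
    rw [← Ideal.Quotient.eq_zero_iff_mem]
    have := hJ a ha (e.symm 1)
    rwa [← map_smul, LinearEquiv.map_eq_zero_iff, Algebra.smul_def, mul_one] at this
  · intro N₁ _ _ _ N₂ _ _ _ N₃ _ _ _ i π hi hπ hiπ h₁ h₃ hJ
    refine .of_exact_tensor hi hπ hiπ (h₁ fun a ha x => hi ?_) (h₃ fun a ha x => ?_)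
    · rw [map_smul, hJ a ha, map_zero]
    · obtain ⟨x, rfl⟩ := hπ x
      rw [← map_smul, hJ a ha, map_zero]

/-- The images of finitely many generators of `K` involve only a finite submodule `I₀` of `I`, and
`R ⊗ I₀` embeds in `R ⊗ I` since `R` is flat. -/
theorem ExtendsAlong.tensor_of_forall_finite {f : K →ₗ[R] F} [Module.Finite R K]
    (h : ∀ (I : Type u) [AddCommGroup I] [Module S I] [Module.Finite S I],
      ExtendsAlong f (R ⊗[S] I)) (I : Type u) [AddCommGroup I] [Module S I] :
    ExtendsAlong f (R ⊗[S] I) := by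
  intro φ
  obtain ⟨s, hs⟩ := Module.Finite.fg_top (R := R) (M := K)
  obtain ⟨I₀, hI, hle⟩ := TensorProduct.exists_finite_submodule_right_of_setFinite
    (φ '' (s : Set K)) (s.finite_toSet.image φ)
  obtain ⟨φ', rfl⟩ := LinearMap.exists_comp_eq_of_injective (tensorMap S R I₀.subtype)
    (Module.Flat.lTensor_preserves_injective_linearMap _ I₀.injective_subtype) φ fun x => by
      have hx : x ∈ Submodule.span R (s : Set K) := hs ▸ trivial
      have : Submodule.span R (s : Set K) ≤
          (LinearMap.range (tensorMap S R I₀.subtype)).comap φ :=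
        Submodule.span_le.2 fun y hy => hle ⟨y, hy, rfl⟩
      exact this hx
  obtain ⟨ψ, rfl⟩ := h I₀ φ'
  exact ⟨tensorMap S R I₀.subtype ∘ₗ ψ, LinearMap.comp_assoc _ _ _⟩

/-- The inclusion `S ⧸ p → k(p)`. -/
noncomputable abbrev quotientToResidueField (p : PrimeSpectrum S) :
    (S ⧸ p.asIdeal) →ₗ[S] p.asIdeal.ResidueField :=
  (Algebra.linearMap (S ⧸ p.asIdeal) p.asIdeal.ResidueField).restrictScalars S

omit [Module.Flat S R] in
theorem exists_smul_eq_tensorMap_quotientToResidueField (p : PrimeSpectrum S)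
    (x : R ⊗[S] p.asIdeal.ResidueField) :
    ∃ a ∉ p.asIdeal, ∃ y, tensorMap S R (quotientToResidueField p) y = algebraMap S R a • x := by
  induction x with
  | zero => exact ⟨1, p.isPrime.one_notMem, 0, by simp⟩
  | tmul r z =>
    obtain ⟨⟨b, c⟩, h⟩ := IsLocalization.surj (nonZeroDivisors (S ⧸ p.asIdeal)) z
    obtain ⟨a, ha⟩ := Ideal.Quotient.mk_surjective (c : S ⧸ p.asIdeal)
    refine ⟨a, fun hap => ?_, r ⊗ₜ b, ?_⟩
    · exact nonZeroDivisors.ne_zero c.2 (ha ▸ Ideal.Quotient.eq_zero_iff_mem.2 hap)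
    · rw [algebraMap_smul, ← TensorProduct.tmul_smul]
      change r ⊗ₜ algebraMap _ _ b = _
      rw [← h, ← ha, Algebra.smul_def, mul_comm]
      rfl
  | add x x' hx hx' =>
    obtain ⟨a, ha, y, hy⟩ := hx
    obtain ⟨a', ha', y', hy'⟩ := hx'
    refine ⟨a * a', p.isPrime.mul_notMem ha ha',
      algebraMap S R a' • y + algebraMap S R a • y', ?_⟩
    rw [map_add, map_smul, map_smul, hy, hy', map_mul, smul_add, mul_smul, mul_smul,
      smul_comm (algebraMap S R a') (algebraMap S R a) x]

omit [Module.Flat S R] in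
theorem exists_smul_eq_comp_quotientToResidueField [Module.Free R F] [Module.Finite R F]
    (p : PrimeSpectrum S) (ψ : F →ₗ[R] R ⊗[S] p.asIdeal.ResidueField) :
    ∃ a ∉ p.asIdeal, ∃ ψ' : F →ₗ[R] R ⊗[S] (S ⧸ p.asIdeal),
      tensorMap S R (quotientToResidueField p) ∘ₗ ψ' = algebraMap S R a • ψ := by
  classical
  let b := Module.Free.chooseBasis R F
  choose a ha y hy using fun i => exists_smul_eq_tensorMap_quotientToResidueField p (ψ (b i))
  -- A common denominator for all basis vectors; `y i` already accounts for `a i`, so it is scaled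
  -- by the remaining factors.
  refine ⟨∏ i, a i, fun h => ?_,
    b.constr R fun i => algebraMap S R (∏ j ∈ Finset.univ.erase i, a j) • y i, b.ext fun i => ?_⟩
  · obtain ⟨i, -, hi⟩ := (p.isPrime.prod_mem_iff).1 h
    exact ha i hi
  · rw [LinearMap.comp_apply, b.constr_basis, map_smul, hy, ← mul_smul, ← map_mul,
      Finset.prod_erase_mul _ _ (Finset.mem_univ i), LinearMap.smul_apply]

theorem ExtendsAlong.tensor_quotient_prime [IsNoetherianRing S] (hR : IsCoherentRing R)
    [Module.FinitePresentation R K] [Module.Free R F] [Module.Finite R F] {f : K →ₗ[R] F}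
    (p : PrimeSpectrum S)
    (hp : p ∈ closedPointsImage S R → ExtendsAlong f (R ⊗[S] p.asIdeal.ResidueField))
    (ih : ∀ q : PrimeSpectrum S, p < q → ExtendsAlong f (R ⊗[S] (S ⧸ q.asIdeal))) :
    ExtendsAlong f (R ⊗[S] (S ⧸ p.asIdeal)) := by
  have : Module.FinitePresentation S (S ⧸ p.asIdeal) := Module.finitePresentation_of_finite _ _
  have := hR.finitePresentation_hom (M := K) (N := R ⊗[S] (S ⧸ p.asIdeal))
  have hpI : ∀ a ∈ p.asIdeal, ∀ x : S ⧸ p.asIdeal, a • x = 0 := fun a ha x => by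
    rw [Algebra.smul_def, Ideal.Quotient.algebraMap_eq, Ideal.Quotient.eq_zero_iff_mem.2 ha,
      zero_mul]
  refine .of_forall_prime f p ?_ ?_ ?_
  · intro a ha φ
    ext x
    rw [LinearMap.smul_apply, algebraMap_smul, LinearMap.zero_apply]
    induction φ x with
    | zero => rw [smul_zero]
    | tmul r z => rw [← TensorProduct.tmul_smul, hpI a ha, TensorProduct.tmul_zero]
    | add x y hx hy => rw [smul_add, hx, hy, add_zero]
  · intro a ha φ
    -- Multiplication by `a` is injective on the domain `S/p`, and its cokernel is killed by `p +
    -- (a)`, so only primes strictly above `p` enter.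
    let i : (S ⧸ p.asIdeal) →ₗ[S] (S ⧸ p.asIdeal) := LinearMap.lsmul S _ a
    have hi : Function.Injective i := by
      rw [injective_iff_map_eq_zero]
      intro z (hz : a • z = 0)
      rw [Algebra.smul_def, mul_eq_zero] at hz
      exact hz.resolve_left fun h => ha (Ideal.Quotient.eq_zero_iff_mem.1 h)
    let π := (LinearMap.range i).mkQ
    have hπ : Function.Surjective π := Submodule.mkQ_surjective _
    have hiπ : Function.Exact i π := LinearMap.exact_map_mkQ_range i
    have hcok : ExtendsAlong f (R ⊗[S] ((S ⧸ p.asIdeal) ⧸ LinearMap.range i)) := by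
      refine .tensor_of_finite (p.asIdeal ⊔ Ideal.span {a}) (fun q hq => ih q ?_) _ ?_
      · refine lt_of_le_of_ne (le_sup_left.trans hq) fun h => ha ?_
        rw [h]
        exact hq (Ideal.mem_sup_right (Ideal.mem_span_singleton_self a))
      · intro c hc z
        obtain ⟨z, rfl⟩ := hπ z
        have : p.asIdeal ⊔ Ideal.span {a} ≤ Ideal.torsionOf S _ (π z) := by
          refine sup_le (fun c hc => ?_) ?_
          · rw [Ideal.mem_torsionOf_iff, ← map_smul, hpI c hc, map_zero]
          · rw [Ideal.span_singleton_le_iff_mem, Ideal.mem_torsionOf_iff, ← map_smul]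
            exact hiπ.apply_apply_eq_zero z
        exact (Ideal.mem_torsionOf_iff _ _).1 (this hc)
    obtain ⟨φ', ψ, hφ⟩ := hcok.exists_decomposition (i := tensorMap S R i) (π := tensorMap S R π)
      (Module.Flat.lTensor_preserves_injective_linearMap i hi) (LinearMap.lTensor_surjective R hπ)
      (lTensor_exact R hiπ hπ) φ
    refine ⟨φ', ψ, ?_⟩
    have h' : tensorMap S R i ∘ₗ φ' = algebraMap S R a • φ' := by
      ext x
      rw [LinearMap.comp_apply, LinearMap.smul_apply, algebraMap_smul]
      induction φ' x with
      | zero => simp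
      | tmul r z => simp [i]
      | add x y hx hy => rw [map_add, hx, hy, smul_add]
    rw [hφ, h']
  · intro hmem φ
    -- Extend over `k(p)`, clear denominators, and descend to `S/p` by injectivity of `R ⊗ S/p → R ⊗
    -- k(p)`.
    obtain ⟨ψ, hψ⟩ := hp hmem (tensorMap S R (quotientToResidueField p) ∘ₗ φ)
    obtain ⟨a, ha, ψ', hψ'⟩ := exists_smul_eq_comp_quotientToResidueField p ψ
    refine ⟨a, ha, ψ', ?_⟩
    have hinj : Function.Injective (tensorMap S R (quotientToResidueField p)) :=
      Module.Flat.lTensor_preserves_injective_linearMap _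
        p.asIdeal.injective_algebraMap_quotient_residueField
    ext x
    apply hinj
    have h₁ := LinearMap.congr_fun hψ' (f x)
    have h₂ := LinearMap.congr_fun hψ x
    simp only [LinearMap.comp_apply, LinearMap.smul_apply] at h₁ h₂
    rw [LinearMap.comp_apply, h₁, h₂, LinearMap.smul_apply, map_smul]

theorem ExtendsAlong.tensor [IsNoetherianRing S] (hR : IsCoherentRing R)
    [Module.FinitePresentation R K] [Module.Free R F] [Module.Finite R F] {f : K →ₗ[R] F}
    (h : ∀ p ∈ closedPointsImage S R, ExtendsAlong f (R ⊗[S] p.asIdeal.ResidueField))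
    (I : Type u) [AddCommGroup I] [Module S I] : ExtendsAlong f (R ⊗[S] I) := by
  have key : ∀ p : PrimeSpectrum S, ExtendsAlong f (R ⊗[S] (S ⧸ p.asIdeal)) := fun p => by
    -- Noetherian induction: larger primes come first.
    induction p using (InvImage.wf PrimeSpectrum.asIdeal
      (wellFounded_gt (α := Ideal S))).induction with
    | h p ih => exact .tensor_quotient_prime hR p (h p) ih
  exact .tensor_of_forall_finite (fun I _ _ _ => .tensor_of_finite ⊥ (fun q _ => key q) I
    fun a ha x => by rw [(Submodule.mem_bot S).1 ha, zero_smul]) I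

/-- If `Ext^i_R(M, R ⊗[S] k(s))` vanishes for all `s` below closed points, then
`Ext^i_R(M, R ⊗[S] I)` vanishes for all `I`. -/
theorem extVanishes_tensor [IsNoetherianRing S] (hR : IsCoherentRing R) (i : ℕ) (M : Type u)
    [AddCommGroup M] [Module R M] [Module.FinitePresentation R M]
    (h : ∀ p ∈ closedPointsImage S R,
      ExtVanishes R M (R ⊗[S] p.asIdeal.ResidueField) (i + 1))
    (I : Type u) [AddCommGroup I] [Module S I] : ExtVanishes R M (R ⊗[S] I) (i + 1) := by
  induction i generalizing M with
  | zero =>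
    obtain ⟨n, g, hg⟩ := Module.Finite.exists_fin' R M
    have hf := (LinearMap.ker g).injective_subtype
    have hfg := LinearMap.exact_subtype_ker_map g
    have := hR.finitePresentation_ker g
    refine (extVanishes_one_iff hf hg hfg).2 (ExtendsAlong.tensor hR (fun p hp => ?_) I)
    exact (extVanishes_one_iff hf hg hfg).1 (h p hp)
  | succ i ih =>
    obtain ⟨n, g, hg⟩ := Module.Finite.exists_fin' R M
    have hf := (LinearMap.ker g).injective_subtype
    have hfg := LinearMap.exact_subtype_ker_map g
    have := hR.finitePresentation_ker g
    exact (extVanishes_succ_iff hf hg hfg i).2 (ih _ fun p hp =>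
      (extVanishes_succ_iff hf hg hfg i).1 (h p hp))

end Vanishing

/-! ### Universally exact complexes of flat modules -/

section UniversallyExact

variable {S : Type u} [CommRing S] {Z G₀ G₁ G₂ : Type u} [AddCommGroup Z] [Module S Z]
  [AddCommGroup G₀] [Module S G₀] [AddCommGroup G₁] [Module S G₁] [AddCommGroup G₂] [Module S G₂]
  [Module.Flat S G₀] [Module.Flat S G₁] [Module.Flat S G₂]
  {k : Z →ₗ[S] G₀} {d₀ : G₀ →ₗ[S] G₁} {d₁ : G₁ →ₗ[S] G₂}

/-- If a complex of flat modules `G₀ → G₁ → G₂` is universally exact at `G₁`, then the kernel of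
`G₀ → G₁` is flat and its formation commutes with tensor products. -/
theorem flat_and_exact_of_universally_exact (hk : Function.Injective k) (hk₀ : Function.Exact k d₀)
    (hd : d₁ ∘ₗ d₀ = 0)
    (h : ∀ (I : Type u) [AddCommGroup I] [Module S I],
      Function.Exact (d₀.rTensor I) (d₁.rTensor I)) :
    Module.Flat S Z ∧ ∀ (I : Type u) [AddCommGroup I] [Module S I],
      Function.Injective (k.rTensor I) ∧ Function.Exact (k.rTensor I) (d₀.rTensor I) := by
  let c : G₁ ⧸ LinearMap.range d₀ →ₗ[S] G₂ :=
    (LinearMap.range d₀).liftQ d₁ (LinearMap.range_le_ker_iff.2 hd)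
  let q := (LinearMap.range d₀).mkQ
  have hq : Function.Surjective q := Submodule.mkQ_surjective _
  have hqd : q ∘ₗ d₀ = 0 := LinearMap.range_le_ker_iff.1 (by simp [q])
  have hcq : c ∘ₗ q = d₁ := Submodule.liftQ_mkQ _ _ _
  -- Universal exactness says that the cokernel of `d₀` embeds universally into the flat module
  -- `G₂`. Flatness then passes down to the image of `d₀` and to `Z`.
  have hc : Module.Flat S (G₁ ⧸ LinearMap.range d₀) := by
    refine flat_of_rTensor_injective c fun I _ _ => ?_
    rw [injective_iff_map_eq_zero]
    intro x hx
    obtain ⟨y, rfl⟩ := LinearMap.rTensor_surjective I hq x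
    rw [← LinearMap.comp_apply, ← LinearMap.rTensor_comp, hcq] at hx
    obtain ⟨z, rfl⟩ := (h I y).1 hx
    rw [← LinearMap.comp_apply, ← LinearMap.rTensor_comp, hqd, LinearMap.rTensor_zero,
      LinearMap.zero_apply]
  have hr := (LinearMap.range d₀).injective_subtype
  have hrq : Function.Exact (LinearMap.range d₀).subtype q := LinearMap.exact_subtype_mkQ _
  have hflat : Module.Flat S (LinearMap.range d₀) := flat_of_exact _ q hr hq hrq
  have hs := d₀.surjective_rangeRestrict
  have hks : Function.Exact k d₀.rangeRestrict := fun y => by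
    rw [← hk₀ y]
    exact Subtype.ext_iff
  refine ⟨flat_of_exact k _ hk hs hks, fun I _ _ => ⟨?_, ?_⟩⟩
  · exact (LinearMap.lTensor_inj_iff_rTensor_inj I k).1
      (LinearMap.lTensor_injective_of_exact_of_flat _ hs k hk hks I)
  · have hinj : Function.Injective ((LinearMap.range d₀).subtype.rTensor I) :=
      (LinearMap.lTensor_inj_iff_rTensor_inj I _).1
        (LinearMap.lTensor_injective_of_exact_of_flat _ hq _ hr hrq I)
    have hcomp : (LinearMap.range d₀).subtype ∘ₗ d₀.rangeRestrict = d₀ := rfl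
    intro y
    rw [← rTensor_exact I hks hs y]
    nth_rw 1 [← hcomp]
    rw [LinearMap.rTensor_comp, LinearMap.comp_apply, map_eq_zero_iff _ hinj]

end UniversallyExact

/-! ### The exchange map -/

section Exchange

variable {S R : Type*} [CommRing S] [CommRing R] [Algebra S R] {M F : Type*} [AddCommGroup M]
  [Module R M] [AddCommGroup F] [Module R F] {I : Type*} [AddCommGroup I] [Module S I]

theorem exchangeMap_naturality (g : F →ₗ[R] M) (x : Module.Dual R M ⊗[S] I) :
    exchangeMap S R F I ((g.dualMap.restrictScalars S).rTensor I x) =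
      exchangeMap S R M I x ∘ₗ g := by
  induction x with
  | zero => simp
  | tmul φ u => rfl
  | add x y hx hy => rw [map_add, map_add, hx, hy, map_add, LinearMap.add_comp]

/-- The inverse is `ψ ↦ ∑ i, j i (ψ (b i))`, where `j i` tensors with the `i`-th dual basis vector.
-/
theorem exchangeMap_bijective_of_free [Module.Free R F] [Module.Finite R F] :
    Function.Bijective (exchangeMap S R F I) := by
  classical
  let b := Module.Free.chooseBasis R F
  let j (i) : R ⊗[S] I →ₗ[R] Module.Dual R F ⊗[S] I :=
    TensorProduct.AlgebraTensorModule.rTensor S I (LinearMap.toSpanSingleton R _ (b.coord i))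
  have hj (i) (z : R ⊗[S] I) (k) : exchangeMap S R F I (j i z) (b k) = if k = i then z else 0 := by
    induction z with
    | zero => simp
    | tmul r u =>
      simp only [j, TensorProduct.AlgebraTensorModule.rTensor_tmul, exchangeMap_tmul,
        LinearMap.toSpanSingleton_apply, LinearMap.smul_apply, Module.Basis.coord_apply,
        Module.Basis.repr_self, Finsupp.single_apply]
      split_ifs <;> simp
    | add x y hx hy => rw [map_add, map_add, LinearMap.add_apply, hx, hy]; split_ifs <;> simp
  have hleft (x : Module.Dual R F ⊗[S] I) : ∑ i, j i (exchangeMap S R F I x (b i)) = x := by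
    induction x with
    | zero => simp
    | tmul φ u =>
      simp only [exchangeMap_tmul, j, TensorProduct.AlgebraTensorModule.rTensor_tmul,
        LinearMap.toSpanSingleton_apply]
      rw [← TensorProduct.sum_tmul]
      congr 1
      refine b.ext fun k => ?_
      simp
    | add x y hx hy => simp only [map_add, LinearMap.add_apply, Finset.sum_add_distrib, hx, hy]
  refine ⟨fun x y h => ?_, fun ψ => ⟨∑ i, j i (ψ (b i)), b.ext fun k => ?_⟩⟩
  · rw [← hleft x, ← hleft y, h]
  · simp [hj]

end Exchange

/-! ### Flatness and base change of the dual -/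

section DualFlat

variable {S R : Type u} [CommRing S] [CommRing R] [Algebra S R] [Module.Flat S R]
  {M : Type u} [AddCommGroup M] [Module R M]

theorem flat_dual_of_free {F : Type u} [AddCommGroup F] [Module R F] [Module.Free R F]
    [Module.Finite R F] : Module.Flat S (Module.Dual R F) :=
  Module.Flat.trans S R _

/-- If `Ext^1_R(M, R ⊗[S] I)` vanishes for all `I`, then the dual of `M` is `S`-flat and its
formation commutes with base change. -/
theorem flat_dual_and_exchangeMap_bijective (hR : IsCoherentRing R) [Module.FinitePresentation R M]
    (h : ∀ (I : Type u) [AddCommGroup I] [Module S I], ExtVanishes R M (R ⊗[S] I) 1) :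
    Module.Flat S (Module.Dual R M) ∧ ∀ (I : Type u) [AddCommGroup I] [Module S I],
      Function.Bijective (exchangeMap S R M I) := by
  obtain ⟨n, g, hg⟩ := Module.Finite.exists_fin' R M
  have hf := (LinearMap.ker g).injective_subtype
  have hfg := LinearMap.exact_subtype_ker_map g
  have := hR.finitePresentation_ker g
  obtain ⟨m, l, π, ρ, hπ, hρπ⟩ := Module.FinitePresentation.exists_fin' R (LinearMap.ker g)
  let d := (LinearMap.ker g).subtype ∘ₗ π
  have hdg : Function.Exact d g := fun y => by
    rw [hfg y]
    exact ⟨fun ⟨x, hx⟩ => (hπ x).imp fun z hz => (congrArg Subtype.val hz).trans hx,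
      fun ⟨z, hz⟩ => ⟨π z, hz⟩⟩
  have hdρ : d ∘ₗ ρ = 0 := by
    rw [LinearMap.comp_assoc, hρπ.linearMap_comp_eq_zero, LinearMap.comp_zero]
  have (k : ℕ) : Module.Flat S (Module.Dual R (Fin k → R)) := flat_dual_of_free
  have key := flat_and_exact_of_universally_exact (k := g.dualMap.restrictScalars S)
    (d₀ := d.dualMap.restrictScalars S) (d₁ := ρ.dualMap.restrictScalars S)
    (LinearMap.lcomp_injective_of_surjective g hg)
    (LinearMap.exact_lcomp_of_exact_of_surjective R hdg hg) ?_ ?_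
  · refine ⟨key.1, fun I _ _ => ?_⟩
    obtain ⟨hinj, hexact⟩ := key.2 I
    constructor
    · refine Function.Injective.of_comp (f := LinearMap.lcomp R (R ⊗[S] I) g) ?_
      have : LinearMap.lcomp R (R ⊗[S] I) g ∘ exchangeMap S R M I =
          exchangeMap S R (Fin n → R) I ∘ (g.dualMap.restrictScalars S).rTensor I :=
        funext fun x => (exchangeMap_naturality g x).symm
      rw [this]
      exact exchangeMap_bijective_of_free.1.comp hinj
    · intro ψ
      obtain ⟨y, hy⟩ := exchangeMap_bijective_of_free.2 (ψ ∘ₗ g)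
      obtain ⟨x, rfl⟩ := (hexact y).1 (exchangeMap_bijective_of_free.1 (by
        rw [exchangeMap_naturality, hy, LinearMap.comp_assoc, hdg.linearMap_comp_eq_zero,
          LinearMap.comp_zero, map_zero]))
      rw [exchangeMap_naturality] at hy
      exact ⟨x, (LinearMap.cancel_right hg).1 hy⟩
  · exact LinearMap.ext fun φ => LinearMap.ext fun x =>
      (congrArg φ (LinearMap.congr_fun hdρ x)).trans (map_zero φ)
  · intro I _ _ y
    constructor
    · intro hy
      have h₁ : exchangeMap S R (Fin m → R) I y ∘ₗ ρ = 0 := by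
        rw [← exchangeMap_naturality, hy, map_zero]
      obtain ⟨φ, hφ⟩ := ((LinearMap.exact_lcomp_of_exact_of_surjective (R ⊗[S] I) hρπ hπ) _).1 h₁
      -- A cocycle is a map on the first syzygy; it is a coboundary because `Ext^1` vanishes.
      obtain ⟨ψ, hψ⟩ := (extVanishes_one_iff hf hg hfg).1 (h I) φ
      obtain ⟨z, rfl⟩ := exchangeMap_bijective_of_free.2 ψ
      refine ⟨z, exchangeMap_bijective_of_free.1 ?_⟩
      rw [exchangeMap_naturality, ← LinearMap.comp_assoc, hψ]
      exact hφ
    · rintro ⟨z, rfl⟩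
      refine exchangeMap_bijective_of_free.1 ?_
      rw [exchangeMap_naturality, exchangeMap_naturality, LinearMap.comp_assoc, hdρ,
        LinearMap.comp_zero, map_zero]

end DualFlat

/-! ### Duals and reflexivity under ring extension -/

section DualBaseChange

variable (R M B : Type*) [CommRing R] [AddCommGroup M] [Module R M] [CommRing B] [Algebra R B]

/-- The base change map `B ⊗ M^* → (B ⊗ M)^*` of the dual. -/
noncomputable def dualTensorMap :
    B ⊗[R] Module.Dual R M →ₗ[B] Module.Dual B (B ⊗[R] M) :=
  LinearMap.liftBaseChange B
    { toFun := fun φ => (Algebra.linearMap R B ∘ₗ φ).liftBaseChange B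
      map_add' := fun φ ψ => by ext m; simp
      map_smul' := fun r φ => by ext m; simp [Algebra.smul_def] }

@[simp]
theorem dualTensorMap_tmul (b b' : B) (φ : Module.Dual R M) (m : M) :
    dualTensorMap R M B (b ⊗ₜ φ) (b' ⊗ₜ m) = b * (b' * algebraMap R B (φ m)) := by
  simp [dualTensorMap]

/-- Compatibility of the evaluation map with base change. -/
theorem dualMap_dualTensorMap_eval (y : B ⊗[R] M) :
    (dualTensorMap R M B).dualMap (Module.Dual.eval B (B ⊗[R] M) y) =
      dualTensorMap R (Module.Dual R M) B ((Module.Dual.eval R M).baseChange B y) := by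
  induction y with
  | zero => simp
  | tmul b m =>
    ext φ
    simp
  | add x y hx hy => simp only [map_add, hx, hy]

variable {R M B}

theorem isReflexive_tensor_iff (h : Function.Bijective (dualTensorMap R M B)) :
    Module.IsReflexive B (B ⊗[R] M) ↔ Function.Bijective
      (dualTensorMap R (Module.Dual R M) B ∘ (Module.Dual.eval R M).baseChange B) := by
  have h' : (dualTensorMap R (Module.Dual R M) B ∘ (Module.Dual.eval R M).baseChange B) =
      (LinearEquiv.ofBijective _ h).dualMap ∘ Module.Dual.eval B (B ⊗[R] M) :=
    funext fun y => (dualMap_dualTensorMap_eval R M B y).symm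
  rw [h', Function.Bijective.of_comp_iff' (LinearEquiv.bijective _)]
  exact ⟨fun h => h.1, fun h => ⟨h⟩⟩

variable {S T : Type*} [CommRing S] [Algebra S R] [AddCommGroup T] [Module S T]

theorem exchangeMap_tensorEquivOfEquiv (e : B ≃ₗ[R] R ⊗[S] T) (z : B ⊗[R] Module.Dual R M)
    (m : M) : exchangeMap S R M T (tensorEquivOfEquiv e _ z) m =
      e (dualTensorMap R M B z (1 ⊗ₜ m)) := by
  induction z with
  | zero => simp
  | tmul b φ =>
    rw [dualTensorMap_tmul, one_mul, mul_comm, ← Algebra.smul_def, map_smul]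
    simp only [tensorEquivOfEquiv, LinearEquiv.trans_apply, TensorProduct.congr_tmul,
      LinearEquiv.refl_apply, TensorProduct.comm_tmul]
    induction e b with
    | zero => simp
    | add x y hx hy => simp only [TensorProduct.tmul_add, map_add, LinearMap.add_apply, hx, hy,
        smul_add]
    | tmul r t => simp [TensorProduct.smul_tmul', mul_comm]
  | add x y hx hy => simp only [map_add, LinearMap.add_apply, hx, hy]

/-- By adjunction and `e`, both maps are the same. Only an `R`-linear `e` is required, so iterated
base changes are covered too. -/
theorem dualTensorMap_bijective_iff (e : B ≃ₗ[R] R ⊗[S] T) :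
    Function.Bijective (dualTensorMap R M B) ↔ Function.Bijective (exchangeMap S R M T) := by
  let Λ : Module.Dual B (B ⊗[R] M) → (M →ₗ[R] R ⊗[S] T) := fun ψ =>
    e.toLinearMap ∘ₗ (LinearMap.liftBaseChangeEquiv B).symm ψ
  have hΛ : Function.Bijective Λ :=
    (e.congrRight (M := M)).bijective.comp (LinearMap.liftBaseChangeEquiv B).symm.bijective
  have h : exchangeMap S R M T ∘ tensorEquivOfEquiv e _ = Λ ∘ dualTensorMap R M B := by
    ext z m
    exact exchangeMap_tensorEquivOfEquiv e z m
  rw [← Function.Bijective.of_comp_iff' hΛ, ← h,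
    Function.Bijective.of_comp_iff _ (LinearEquiv.bijective _)]

end DualBaseChange

/-! ### Fibre criteria -/

section Fibres

theorem subsingleton_of_forall_isMaximal {R Q : Type*} [CommRing R] [AddCommGroup Q] [Module R Q]
    [Module.Finite R Q] (h : ∀ m : Ideal R, m.IsMaximal → Subsingleton ((R ⧸ m) ⊗[R] Q)) :
    Subsingleton Q := by
  refine subsingleton_of_forall_eq 0 fun x => ?_
  by_contra hx
  have hne : Ideal.torsionOf R Q x ≠ ⊤ := by
    rwa [Ne, Ideal.torsionOf_eq_top_iff]
  obtain ⟨m, hm, hle⟩ := Ideal.exists_le_maximal _ hne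
  have := h m hm
  have := (TensorProduct.quotTensorEquivQuotSMul Q m).symm.injective.subsingleton
  have htop := Submodule.Quotient.subsingleton_iff.1 this
  obtain ⟨r, hr, hr'⟩ := Submodule.exists_sub_one_mem_and_smul_eq_zero_of_fg_of_le_smul m ⊤
    Module.Finite.fg_top htop.ge
  have hrm := hle ((Ideal.mem_torsionOf_iff _ _).2 (hr' x trivial))
  refine hm.ne_top ((Ideal.eq_top_iff_one m).2 ?_)
  simpa using m.sub_mem hrm hr

theorem subsingleton_tensor_of_algHom {R B C Q : Type*} [CommRing R] [CommRing B] [Algebra R B]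
    [CommRing C] [Algebra R C] [AddCommGroup Q] [Module R Q] (f : B →ₐ[R] C)
    [Subsingleton (B ⊗[R] Q)] : Subsingleton (C ⊗[R] Q) := by
  refine subsingleton_of_forall_eq 0 fun z => ?_
  induction z with
  | zero => rfl
  | tmul c q =>
    have : (1 : B) ⊗ₜ[R] q = 0 := Subsingleton.elim _ _
    have h := congrArg (f.toLinearMap.rTensor Q) this
    simp only [LinearMap.rTensor_tmul, AlgHom.toLinearMap_apply, map_one, map_zero] at h
    rw [← mul_one c, ← smul_eq_mul, ← TensorProduct.smul_tmul', h, smul_zero]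
  | add x y hx hy => rw [hx, hy, add_zero]

variable {S R : Type*} [CommRing S] [CommRing R] [Algebra S R]

/-- A finite module all of whose fibres below closed points vanish is zero. -/
theorem subsingleton_of_fibres {Q : Type*} [AddCommGroup Q] [Module R Q] [Module.Finite R Q]
    (h : ∀ s ∈ closedPointsImage S R, Subsingleton ((R ⊗[S] s.asIdeal.ResidueField) ⊗[R] Q)) :
    Subsingleton Q := by
  refine subsingleton_of_forall_isMaximal (R := R) fun m hm => ?_
  let y : PrimeSpectrum R := ⟨m, hm.isPrime⟩
  let s := PrimeSpectrum.comap (algebraMap S R) y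
  have hs : s ∈ closedPointsImage S R :=
    ⟨y, (PrimeSpectrum.isClosed_singleton_iff_isMaximal y).2 hm, rfl⟩
  have hmem (a : S) : algebraMap S (R ⧸ m) a = 0 ↔ a ∈ s.asIdeal := by
    rw [IsScalarTower.algebraMap_apply S R (R ⧸ m)]
    exact Ideal.Quotient.eq_zero_iff_mem
  let := Ideal.Quotient.field m
  -- The fibre ring over `s` maps to `R/m`, so vanishing of the fibre forces `Q/mQ = 0`.
  let k : s.asIdeal.ResidueField →ₐ[S] R ⧸ m :=
    Ideal.ResidueField.liftₐ s.asIdeal (Algebra.ofId S (R ⧸ m)) (fun a ha => (hmem a).2 ha)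
      fun a ha => (isUnit_iff_ne_zero (a := algebraMap S (R ⧸ m) a)).2 fun h0 => ha ((hmem a).1 h0)
  have := h s hs
  exact subsingleton_tensor_of_algHom
    (Algebra.TensorProduct.lift (Algebra.ofId R (R ⧸ m)) k fun _ _ => Commute.all _ _)

/-- A map from a finite module to a finitely presented `S`-flat module which is bijective on the
fibres below closed points is bijective. -/
theorem bijective_of_fibres {M N : Type*} [AddCommGroup M] [Module R M] [AddCommGroup N]
    [Module R N] [Module S M] [IsScalarTower S R M] [Module S N] [IsScalarTower S R N]
    [Module.Flat S N] [Module.Finite R M] [Module.FinitePresentation R N] (f : M →ₗ[R] N)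
    (h : ∀ s ∈ closedPointsImage S R,
      Function.Bijective (f.lTensor (R ⊗[S] s.asIdeal.ResidueField))) :
    Function.Bijective f := by
  have hsurj : Function.Surjective f := by
    rw [← LinearMap.range_eq_top, ← Submodule.Quotient.subsingleton_iff]
    refine subsingleton_of_fibres (S := S) (R := R) fun s hs => ?_
    have hq : Function.Surjective ((LinearMap.range f).mkQ.lTensor
        (R ⊗[S] s.asIdeal.ResidueField)) :=
      LinearMap.lTensor_surjective _ (Submodule.mkQ_surjective _)
    refine subsingleton_of_forall_eq 0 fun z => ?_
    obtain ⟨y, rfl⟩ := hq z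
    obtain ⟨x, rfl⟩ := (h s hs).2 y
    rw [← LinearMap.comp_apply, ← LinearMap.lTensor_comp, LinearMap.range_mkQ_comp,
      LinearMap.lTensor_zero, LinearMap.zero_apply]
  refine ⟨?_, hsurj⟩
  have : Module.Finite R (LinearMap.ker f) :=
    .of_fg (Module.FinitePresentation.fg_ker f hsurj)
  rw [← LinearMap.ker_eq_bot, ← Submodule.subsingleton_iff_eq_bot]
  refine subsingleton_of_fibres (S := S) (R := R) fun s hs => ?_
  -- Flatness of `N` embeds the fibre of the kernel in the fibre of `M`, where it dies by
  -- injectivity of `f` on fibres.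
  have hi := lTensor_injective_of_equiv_tensorProduct
    (LinearEquiv.refl R (R ⊗[S] s.asIdeal.ResidueField)) (LinearMap.ker f).injective_subtype hsurj
    (LinearMap.exact_subtype_ker_map f)
  refine subsingleton_of_forall_eq 0 fun z => hi ((h s hs).1 ?_)
  rw [← LinearMap.comp_apply, ← LinearMap.lTensor_comp, LinearMap.comp_ker_subtype,
    LinearMap.lTensor_zero, LinearMap.zero_apply, map_zero, map_zero]

end Fibres

/-! ### The absolute notion -/

section StablyReflexive

variable {A M N : Type u} [CommRing A] [AddCommGroup M] [Module A M] [AddCommGroup N] [Module A N]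
  {n : ℕ}

theorem IsNStablyReflexive.congr (e : M ≃ₗ[A] N) (h : IsNStablyReflexive n A M) :
    IsNStablyReflexive n A N := by
  have := h.1
  refine ⟨Module.equiv e, fun i h₀ hn => ?_⟩
  exact ⟨(h.2 i h₀ hn).1.congr e (.refl A A), (h.2 i h₀ hn).2.congr e.symm.dualMap (.refl A A)⟩

theorem IsNStablyReflexive.dual (h : IsNStablyReflexive n A M) :
    IsNStablyReflexive n A (Module.Dual A M) := by
  have := h.1
  refine ⟨inferInstance, fun i h₀ hn => ⟨(h.2 i h₀ hn).2, ?_⟩⟩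
  exact (h.2 i h₀ hn).1.congr (Module.evalEquiv A M) (.refl A A)

end StablyReflexive

/-! ### Fibrewise and universal conditions -/

section UniversallyReflexive

/-- The conditions on `M` over `S → R`, in terms of all `S`-modules `I`, that are equivalent to
`n`-stable reflexivity. -/
structure IsUniversallyReflexive (n : ℕ) (S R M : Type u) [CommRing S] [CommRing R] [Algebra S R]
    [AddCommGroup M] [Module S M] [Module R M] [IsScalarTower S R M] : Prop where
  flat : Module.Flat S M
  flat_dual : Module.Flat S (Module.Dual R M)
  isReflexive : Module.IsReflexive R M
  exchange (I : Type u) [AddCommGroup I] [Module S I] : Function.Bijective (exchangeMap S R M I)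
  exchange_dual (I : Type u) [AddCommGroup I] [Module S I] :
    Function.Bijective (exchangeMap S R (Module.Dual R M) I)
  ext (I : Type u) [AddCommGroup I] [Module S I] (i : ℕ) (h₀ : 0 < i) (hn : i < n) :
    ExtVanishes R M (R ⊗[S] I) i
  ext_dual (I : Type u) [AddCommGroup I] [Module S I] (i : ℕ) (h₀ : 0 < i) (hn : i < n) :
    ExtVanishes R (Module.Dual R M) (R ⊗[S] I) i

variable {n : ℕ} {S R M : Type u} [CommRing S] [CommRing R] [Algebra S R] [Module.Flat S R]
  [AddCommGroup M] [Module S M] [Module R M] [IsScalarTower S R M]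

theorem IsUniversallyReflexive.baseChange (h : IsUniversallyReflexive n S R M) {B T : Type u}
    [CommRing B] [Algebra R B] [AddCommGroup T] [Module S T] (e : B ≃ₗ[R] R ⊗[S] T) :
    IsNStablyReflexive n B (B ⊗[R] M) := by
  have := h.flat
  have := h.flat_dual
  have := h.isReflexive
  have hδ := (dualTensorMap_bijective_iff e).2 (h.exchange T)
  refine ⟨(isReflexive_tensor_iff hδ).2 ?_, fun i h₀ hn => ?_⟩
  · refine ((dualTensorMap_bijective_iff e).2 (h.exchange_dual T)).comp ?_
    exact ((Module.evalEquiv R M).baseChange R B _ _).bijective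
  · obtain ⟨i, rfl⟩ := Nat.exists_eq_succ_of_ne_zero h₀.ne'
    constructor
    · rw [extVanishes_baseChange_iff e]
      exact (h.ext T _ h₀ hn).congr (.refl R M) e.symm
    · refine ExtVanishes.congr (LinearEquiv.ofBijective _ hδ) (.refl B B) ?_
      rw [extVanishes_baseChange_iff e]
      exact (h.ext_dual T _ h₀ hn).congr (.refl R _) e.symm

theorem IsUniversallyReflexive.isNStablyReflexiveOver (h : IsUniversallyReflexive n S R M) :
    IsNStablyReflexiveOver n S R M :=
  ⟨h.flat, fun _ _ => h.baseChange (.refl R _)⟩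

theorem IsNStablyReflexiveOver.extVanishes [IsNoetherianRing S] (hR : IsCoherentRing R)
    [Module.FinitePresentation R M] (h : IsNStablyReflexiveOver n S R M) (I : Type u)
    [AddCommGroup I] [Module S I] (i : ℕ) (h₀ : 0 < i) (hn : i < n) :
    ExtVanishes R M (R ⊗[S] I) i := by
  have := h.1
  obtain ⟨i, rfl⟩ := Nat.exists_eq_succ_of_ne_zero h₀.ne'
  exact extVanishes_tensor hR i M (fun p hp =>
    (extVanishes_baseChange_iff (.refl R _) i M).1 ((h.2 p hp).2 _ h₀ hn).1) I

/-- As `n > 1`, `Ext^1` vanishes and the fibres of `M^*` are the duals of the fibres of `M`; the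
absolute notion is self-dual. -/
theorem IsNStablyReflexiveOver.dual [IsNoetherianRing S] (hR : IsCoherentRing R)
    [Module.FinitePresentation R M] (hn : 1 < n) (h : IsNStablyReflexiveOver n S R M) :
    IsNStablyReflexiveOver n S R (Module.Dual R M) := by
  obtain ⟨hflat, hexch⟩ := flat_dual_and_exchangeMap_bijective (S := S) (M := M) hR
    fun I _ _ => h.extVanishes hR I 1 one_pos hn
  refine ⟨hflat, fun s hs => (h.2 s hs).dual.congr (LinearEquiv.ofBijective _
    ((dualTensorMap_bijective_iff (.refl R _)).2 (hexch s.asIdeal.ResidueField))).symm⟩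

theorem IsNStablyReflexiveOver.isUniversallyReflexive [IsNoetherianRing S] (hR : IsCoherentRing R)
    [Module.FinitePresentation R M] (hn : 1 < n) (h : IsNStablyReflexiveOver n S R M) :
    IsUniversallyReflexive n S R M := by
  have hd := h.dual hR hn
  have hd₁ : Module.FinitePresentation R (Module.Dual R M) := hR.finitePresentation_hom
  have hd₂ : Module.FinitePresentation R (Module.Dual R (Module.Dual R M)) :=
    hR.finitePresentation_hom
  obtain ⟨hflat, hexch⟩ := flat_dual_and_exchangeMap_bijective (S := S) (M := M) hR
    fun I _ _ => h.extVanishes hR I 1 one_pos hn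
  obtain ⟨hflat', hexch'⟩ := flat_dual_and_exchangeMap_bijective (S := S)
    (M := Module.Dual R M) hR fun I _ _ => hd.extVanishes hR I 1 one_pos hn
  refine ⟨h.1, hflat, ⟨?_⟩, hexch, hexch', h.extVanishes hR, hd.extVanishes hR⟩
  -- The fibre of `M → M^{**}` is, up to base change isomorphisms, the evaluation map of the fibre;
  -- `M^{**}` is flat by `hflat'`.
  refine bijective_of_fibres (S := S) _ fun s hs => ?_
  have h₁ := (dualTensorMap_bijective_iff (M := M) (.refl R _)).2
    (hexch s.asIdeal.ResidueField)
  have h₂ := (dualTensorMap_bijective_iff (M := Module.Dual R M) (.refl R _)).2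
    (hexch' s.asIdeal.ResidueField)
  exact (Function.Bijective.of_comp_iff' h₂ _).1 ((isReflexive_tensor_iff h₁).1 (h.2 s hs).1)

end UniversallyReflexive

/-! ### Iterated base change -/

section Tower

variable (S R S' J M : Type*) [CommRing S] [CommRing R] [CommRing S'] [Algebra S R] [Algebra S S']
  [AddCommGroup J] [Module S J] [Module S' J] [IsScalarTower S S' J]
  [AddCommGroup M] [Module R M] [Module S M] [IsScalarTower S R M]

/-- The canonical isomorphism `(R ⊗[S] S') ⊗[S'] J ≃ R ⊗[S] J`, additively. -/
noncomputable def rightCancelAddEquiv : (R ⊗[S] S') ⊗[S'] J ≃+ R ⊗[S] J :=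
  (TensorProduct.comm S' (R ⊗[S] S') J ≪≫ₗ
    TensorProduct.congr (LinearEquiv.refl S' J)
      (Algebra.TensorProduct.commRight S S' R).symm.toLinearEquiv ≪≫ₗ
    TensorProduct.AlgebraTensorModule.cancelBaseChange S S' S' J R).toAddEquiv.trans
    (TensorProduct.comm S J R).toAddEquiv

theorem rightCancelAddEquiv_tmul (r : R) (t : S') (u : J) :
    rightCancelAddEquiv S R S' J ((r ⊗ₜ t) ⊗ₜ u) = r ⊗ₜ (t • u) := by
  simp [rightCancelAddEquiv]

/-- The canonical isomorphism `(R ⊗[S] S') ⊗[S'] J ≃ R ⊗[S] J`. -/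
noncomputable def rightCancelBaseChange : (R ⊗[S] S') ⊗[S'] J ≃ₗ[R] R ⊗[S] J where
  __ := rightCancelAddEquiv S R S' J
  map_smul' r z := by
    change rightCancelAddEquiv S R S' J (r • z) = r • rightCancelAddEquiv S R S' J z
    induction z with
    | zero => simp
    | add x y hx hy => rw [smul_add, map_add, hx, hy, map_add, smul_add]
    | tmul x u =>
      induction x with
      | zero => simp
      | add x y hx hy => rw [TensorProduct.add_tmul, smul_add, map_add, hx, hy, map_add, smul_add]
      | tmul a t =>
        rw [TensorProduct.smul_tmul', TensorProduct.smul_tmul', rightCancelAddEquiv_tmul,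
          rightCancelAddEquiv_tmul, TensorProduct.smul_tmul']

theorem rightCancelBaseChange_tmul (r : R) (t : S') (u : J) :
    rightCancelBaseChange S R S' J ((r ⊗ₜ t) ⊗ₜ u) = r ⊗ₜ (t • u) :=
  rightCancelAddEquiv_tmul S R S' J r t u

/-- The module `BaseChangeModule S R S' M` is the base change of the `S`-module `M` to `S'`. -/
noncomputable def baseChangeModuleEquivRight : BaseChangeModule S R S' M ≃ₗ[S'] S' ⊗[S] M where
  __ := (baseChangeModuleEquiv S R S' M).toAddEquiv.trans (TensorProduct.comm S M S').toAddEquiv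
  map_smul' t z := by
    change TensorProduct.comm S M S' (baseChangeModuleEquiv S R S' M (t • z)) =
      t • TensorProduct.comm S M S' (baseChangeModuleEquiv S R S' M z)
    induction z using TensorProduct.induction_on with
    | zero => simp
    | add x y hx hy => rw [smul_add, map_add, map_add, hx, hy, map_add, map_add, smul_add]
    | tmul x m =>
      induction x with
      | zero => simp
      | add x y hx hy =>
        rw [TensorProduct.add_tmul, smul_add, map_add, map_add, hx, hy, map_add, map_add, smul_add]
      | tmul a t' =>
        have h : t • (a ⊗ₜ t' : R ⊗[S] S') = a ⊗ₜ (t * t') := by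
          rw [Algebra.smul_def, Algebra.TensorProduct.right_algebraMap_apply]
          simp
        rw [TensorProduct.smul_tmul', h, baseChangeModuleEquiv_tmul, baseChangeModuleEquiv_tmul,
          TensorProduct.comm_tmul, TensorProduct.comm_tmul, TensorProduct.smul_tmul', smul_eq_mul]

theorem flat_baseChangeModule [Module.Flat S M] : Module.Flat S' (BaseChangeModule S R S' M) :=
  .of_linearEquiv (baseChangeModuleEquivRight S R S' M)

omit [Module S M] [IsScalarTower S R M] in
theorem dualBaseChangeMap_bijective_iff : Function.Bijective (dualBaseChangeMap S R M S' J) ↔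
    Function.Bijective (exchangeMap S R M J) := by
  let Λ : (BaseChangeModule S R S' M →ₗ[R ⊗[S] S'] (R ⊗[S] S') ⊗[S'] J) →
      (M →ₗ[R] R ⊗[S] J) := fun ψ =>
    (rightCancelBaseChange S R S' J).toLinearMap ∘ₗ
      (LinearMap.liftBaseChangeEquiv (R ⊗[S] S')).symm ψ
  have hΛ : Function.Bijective Λ :=
    ((rightCancelBaseChange S R S' J).congrRight (M := M)).bijective.comp
      (LinearMap.liftBaseChangeEquiv (R ⊗[S] S')).symm.bijective
  have h : Λ ∘ dualBaseChangeMap S R M S' J = exchangeMap S R M J := by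
    ext z m
    change rightCancelBaseChange S R S' J (dualBaseChangeMap S R M S' J z (1 ⊗ₜ m)) = _
    induction z with
    | zero => simp
    | add x y hx hy => simp only [map_add, LinearMap.add_apply, hx, hy]
    | tmul φ u =>
      rw [dualBaseChangeMap_tmul, one_mul, rightCancelBaseChange_tmul, one_smul, exchangeMap_tmul]
  rw [← Function.Bijective.of_comp_iff' hΛ, h]

end Tower

/-! ### Comparison with Knudsen's notion -/

section Knudsen

variable {S R M : Type u} [CommRing S] [CommRing R] [Algebra S R] [Module.Flat S R]
  [AddCommGroup M] [Module S M] [Module R M] [IsScalarTower S R M]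

omit [Module.Flat S R] in
theorem tensorMap_comp_exchangeMap {I J : Type*} [AddCommGroup I] [Module S I] [AddCommGroup J]
    [Module S J] (j : I →ₗ[S] J) {D : Type*} [AddCommGroup D] [Module R D]
    (x : Module.Dual R D ⊗[S] I) :
    tensorMap S R j ∘ₗ exchangeMap S R D I x = exchangeMap S R D J (j.lTensor _ x) := by
  induction x with
  | zero => simp
  | tmul φ u => rfl
  | add x y hx hy => rw [map_add, LinearMap.comp_add, hx, hy, map_add, map_add]

/-- The functor `Hom(D, R ⊗ -)` preserves injections as `R` is flat, and `D^* ⊗ -` embeds naturally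
in it. -/
theorem flat_dual_of_exchangeMap_injective {D : Type u} [AddCommGroup D] [Module R D]
    (h : ∀ (I : Type u) [AddCommGroup I] [Module S I], Function.Injective (exchangeMap S R D I)) :
    Module.Flat S (Module.Dual R D) := by
  rw [Module.Flat.iff_lTensor_preserves_injective_linearMap]
  intro I J _ _ _ _ j hj
  refine Function.Injective.of_comp (f := exchangeMap S R D J) ?_
  have : exchangeMap S R D J ∘ j.lTensor _ =
      (fun ψ => tensorMap S R j ∘ₗ ψ) ∘ exchangeMap S R D I :=
    funext fun x => (tensorMap_comp_exchangeMap j x).symm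
  rw [this]
  have hj' : Function.Injective (tensorMap S R j) :=
    Module.Flat.lTensor_preserves_injective_linearMap j hj
  exact Function.Injective.comp (fun ψ ψ' hψ => (LinearMap.cancel_left hj').1 hψ) (h I)

theorem exchangeMap_self_bijective (S R D : Type*) [CommRing S] [CommRing R] [Algebra S R]
    [AddCommGroup D] [Module R D] : Function.Bijective (exchangeMap S R D S) := by
  let E := (TensorProduct.AlgebraTensorModule.rid S R R).congrRight (M := D)
  have h : E ∘ exchangeMap S R D S =
      TensorProduct.AlgebraTensorModule.rid S R (Module.Dual R D) := by
    ext x d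
    induction x with
    | zero => simp
    | tmul φ u =>
      change TensorProduct.AlgebraTensorModule.rid S R R (φ d ⊗ₜ u) = _
      simp
    | add x y hx hy =>
      simp only [Function.comp_apply, map_add, LinearMap.add_apply] at hx hy ⊢
      rw [hx, hy]
  rw [← Function.Bijective.of_comp_iff' E.bijective, h]
  exact LinearEquiv.bijective _

/-- Condition (b) with `I = S` is reflexivity. Cancelling evaluation from (b) gives the exchange
maps of `M^*`, so `M ≅ M^{**}` is flat, being a dual with injective exchange maps. -/
theorem IsKnudsenStablyReflexive.isUniversallyReflexive (h : IsKnudsenStablyReflexive S R M)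
    (n : ℕ) : IsUniversallyReflexive n S R M := by
  have hrefl : Module.IsReflexive R M := by
    have h₁ := (h.2 S).2.1
    rw [LinearMap.coe_comp, Function.Bijective.of_comp_iff' (exchangeMap_self_bijective S R _)]
      at h₁
    have h₂ : Module.Dual.eval R M ∘ TensorProduct.AlgebraTensorModule.rid S R M =
        TensorProduct.AlgebraTensorModule.rid S R (Module.Dual R (Module.Dual R M)) ∘
          TensorProduct.AlgebraTensorModule.map (Module.Dual.eval R M) LinearMap.id := by
      ext x φ
      induction x with
      | zero => simp
      | tmul m a => simp
      | add x y hx hy =>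
        simp only [Function.comp_apply, map_add, LinearMap.add_apply] at hx hy ⊢
        rw [hx, hy]
    refine ⟨(Function.Bijective.of_comp_iff _
      (TensorProduct.AlgebraTensorModule.rid S R M).bijective).1 ?_⟩
    rw [h₂]
    exact (LinearEquiv.bijective _).comp h₁
  have hdual (I : Type u) [AddCommGroup I] [Module S I] :
      Function.Bijective (exchangeMap S R (Module.Dual R M) I) :=
    (Function.Bijective.of_comp_iff _ (TensorProduct.AlgebraTensorModule.congr
      (Module.evalEquiv R M) (LinearEquiv.refl S I)).bijective).1 (h.2 I).2.1
  have := flat_dual_of_exchangeMap_injective (S := S) fun I _ _ => (hdual I).1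
  exact ⟨.of_linearEquiv ((Module.evalEquiv R M).restrictScalars S),
    flat_dual_of_exchangeMap_injective fun I _ _ => (h.2 I).1.1, hrefl, fun I _ _ => (h.2 I).1,
    hdual, fun I _ _ i h₀ _ => ((h.2 I).2.2 i h₀).1, fun I _ _ i h₀ _ => ((h.2 I).2.2 i h₀).2⟩

omit [Module.Flat S R] in
theorem IsUniversallyReflexive.isKnudsenStablyReflexive [Module.Finite R M]
    (h : ∀ n, 1 < n → IsUniversallyReflexive n S R M) : IsKnudsenStablyReflexive S R M := by
  have h₂ := h 2 one_lt_two
  have := h₂.isReflexive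
  refine ⟨inferInstance, fun I _ _ => ⟨h₂.exchange I, ?_, fun i hi => ?_⟩⟩
  · refine (h₂.exchange_dual I).comp ?_
    exact (TensorProduct.AlgebraTensorModule.congr (Module.evalEquiv R M)
      (LinearEquiv.refl S I)).bijective
  · have h₃ := h (i + 1) (by omega)
    exact ⟨h₃.ext I i hi i.lt_succ_self, h₃.ext_dual I i hi i.lt_succ_self⟩

end Knudsen

/-! ### The main theorem -/

theorem mainTheorem2 (S R : Type u) [CommRing S] [CommRing R] [Algebra S R] [Module.Flat S R]
    [IsNoetherianRing S]
    (M : Type u) [AddCommGroup M] [Module S M] [Module R M] [IsScalarTower S R M] :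
    (IsCoherentRing R → IsCoherentModule R M → ∀ n : ℕ, 1 < n → IsNStablyReflexiveOver n S R M →
      (∀ (S' : Type u) [CommRing S'] [Algebra S S'],
        IsNStablyReflexiveOver n S' (R ⊗[S] S') (BaseChangeModule S R S' M) ∧
        IsNStablyReflexive n (R ⊗[S] S') (BaseChangeModule S R S' M)) ∧
      IsNStablyReflexiveOver n S R (Module.Dual R M) ∧
      (∀ (S' : Type u) [CommRing S'] [Algebra S S'] (I' : Type u) [AddCommGroup I']
        [Module S I'] [Module S' I'] [IsScalarTower S S' I'],
        Function.Bijective (dualBaseChangeMap S R M S' I') ∧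
        ∀ i : ℕ, 0 < i → i < n →
          ExtVanishes (R ⊗[S] S') (BaseChangeModule S R S' M) ((R ⊗[S] S') ⊗[S'] I') i)) ∧
    (IsNoetherianRing R → Module.Finite R M →
      (IsStablyReflexiveOver S R M ↔ IsKnudsenStablyReflexive S R M)) := by
  refine ⟨fun hR hM n hn h => ?_, fun hR hM => ⟨fun h => ?_, fun h n _ => ?_⟩⟩
  · have := hM.finitePresentation
    have hu := h.isUniversallyReflexive hR hn
    have := hu.flat
    refine ⟨fun S' _ _ => ⟨⟨flat_baseChangeModule S R S' M, fun s _ => ?_⟩,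
      hu.baseChange (.refl R _)⟩, h.dual hR hn, fun S' _ _ I' _ _ _ _ =>
        ⟨(dualBaseChangeMap_bijective_iff S R S' I' M).2 (hu.exchange I'), fun i h₀ hi => ?_⟩⟩
    -- As an `R`-module, the fibre ring at a point `s` of `Spec S'` is `R ⊗[S] k(s)`, so this fibre
    -- of `M'` is a base change of `M` itself, at every `s`.
    · exact (hu.baseChange (rightCancelBaseChange S R S' s.asIdeal.ResidueField)).congr
        (TensorProduct.AlgebraTensorModule.cancelBaseChange R (R ⊗[S] S') _ _ M).symm
    · obtain ⟨i, rfl⟩ := Nat.exists_eq_succ_of_ne_zero h₀.ne'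
      rw [extVanishes_baseChange_iff (S := S) (.refl R (R ⊗[S] S'))]
      exact (hu.ext I' _ h₀ hi).congr (.refl R M) (rightCancelBaseChange S R S' I').symm
  · have := Module.finitePresentation_of_finite R M
    exact IsUniversallyReflexive.isKnudsenStablyReflexive fun n hn =>
      (h n (zero_lt_one.trans hn)).isUniversallyReflexive isCoherentRing_of_isNoetherianRing hn
  · exact (h.isUniversallyReflexive n).isNStablyReflexiveOver
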